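/- **Proposition 2.2 (euler).** Let $S=\mathbb{Q}[x_1,\dots,x_d]$ and let $\Sigma$ be a $d$-dimensional hereditary rational polyhedral fan in $\mathbb{Q}^d$; that is, a finite set of finitely generated rational cones, closed under taking faces, any two of which meet in a common face, containing a $d$-dimensional cone, and such that for every face $\sigma$ of $\Sigma$ the dual graph of the star of $\sigma$ (vertices: the $d$-dimensional cones containing $\sigma$; edges: pairs sharing a $(d-1)$-dimensional face) is nonempty and connected. Let $\Sigma_i^0$ be the set of interior $i$-dimensional faces of $\Sigma$, i.e. those not contained in a $(d-1)$-dimensional face that lies in exactly one $d$-dimensional cone, and let $f_i^0=|\Sigma_i^0|$. For a face $\xi$ let $I_\xi\subseteq S$ be the ideal of polynomials vanishing on the linear span of $\xi$. Let $C^0(\Sigma)$ be the graded $S$-module of families $(p_\sigma)_\sigma$ of polynomials in $S$, one for each $d$-dimensional cone $\sigma$ of $\Sigma$, such that $p_\sigma$ and $p_{\sigma'}$ agree on $\tau$ whenever $\sigma,\sigma'$ share a $(d-1)$-dimensional face $\tau$. Fix arbitrary orientations of the interior faces and let $\mathcal{C}$ be $$0\to\bigoplus_{\sigma\in\Sigma_d}S\xrightarrow{\partial_d}\bigoplus_{\tau\in\Sigma_{d-1}^0}S/I_\tau\xrightarrow{\partial_{d-1}}\cdots\xrightarrow{\partial_2}\bigoplus_{v\in\Sigma_1^0}S/I_v\to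 0,$$ where the component $S/I_\sigma\to S/I_\tau$ of $\partial_i$ is the cellular incidence number ($\pm1$, determined by the orientations) times the canonical projection if $\tau$ is a face of $\sigma$, and zero otherwise. For a graded module $M$ with finite-dimensional graded pieces let $HP(M,k)$ denote its Hilbert polynomial, the polynomial in $k$ that equals $\dim_{\mathbb{Q}}M_k$ for all sufficiently large integers $k$. Then $\mathcal{C}$ is a complex of graded $S$-modules (consecutive maps compose to zero), the Hilbert polynomials of $C^0(\Sigma)$ and of the homology modules $H_i(\mathcal{C})$, $1\le i\le d-1$, exist, and, as polynomials in $k$, $$HP(C^0(\Sigma),k)=\sum_{i=1}^d(-1)^{d-i}f_i^0\binom{k+i-1}{i-1}+\sum_{i=1}^{d-1}(-1)^{d-1-i}HP(H_i(\mathcal{C}),k).$$ -/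

import Mathlib

open MvPolynomial Filter

/-- The linear span of a cone in `ℚ^d`. -/
abbrev coneSpan {d : ℕ} (σ : PointedCone ℚ (Fin d → ℚ)) : Submodule ℚ (Fin d → ℚ) :=
  Submodule.span ℚ (σ : Set (Fin d → ℚ))

/-- The dimension of a cone: the dimension of its linear span. -/
noncomputable def coneDim {d : ℕ} (σ : PointedCone ℚ (Fin d → ℚ)) : ℕ :=
  Module.finrank ℚ (coneSpan σ)

lemma coneSpan_mono {d : ℕ} {τ σ : PointedCone ℚ (Fin d → ℚ)} (h : τ ≤ σ) :
    coneSpan τ ≤ coneSpan σ :=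
  Submodule.span_mono h

/-- The ideal of the linear span of a cone, in `S = ℚ[x_1, …, x_d]`. -/
noncomputable def coneIdeal {d : ℕ} (σ : PointedCone ℚ (Fin d → ℚ)) :
    Ideal (MvPolynomial (Fin d) ℚ) :=
  vanishingIdeal ℚ (coneSpan σ : Set (Fin d → ℚ))

lemma coneIdeal_anti {d : ℕ} {τ σ : PointedCone ℚ (Fin d → ℚ)} (h : τ ≤ σ) :
    coneIdeal σ ≤ coneIdeal τ :=
  vanishingIdeal_anti_mono (coneSpan_mono h)

/-- A rational polyhedral fan in `ℚ^d`: a finite set of finitely generated cones, closed under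
taking faces, any two of which meet in a common face. -/
structure PolyhedralFan (d : ℕ) where
  cones : Finset (PointedCone ℚ (Fin d → ℚ))
  fg : ∀ σ ∈ cones, Submodule.FG σ
  face_mem : ∀ σ ∈ cones, ∀ τ : PointedCone ℚ (Fin d → ℚ), τ.IsFaceOf σ → τ ∈ cones
  inter_face : ∀ σ ∈ cones, ∀ τ ∈ cones, (σ ⊓ τ).IsFaceOf σ

namespace PolyhedralFan

variable {d : ℕ}

/-- The fan is `d`-dimensional: it has a cone of dimension `d`. -/
def IsFullDimensional (F : PolyhedralFan d) : Prop :=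
  ∃ σ ∈ F.cones, coneDim σ = d

/-- The `d`-dimensional cones of the fan. -/
abbrev MaxCone (F : PolyhedralFan d) : Type :=
  {σ : PointedCone ℚ (Fin d → ℚ) // σ ∈ F.cones ∧ coneDim σ = d}

/-- The dual graph of the star of `σ`: the vertices are the `d`-dimensional cones that contain `σ`,
and two of them are adjacent when they share a `(d-1)`-dimensional face.
(Inside a fan, `τ ≤ σ` holds exactly when `τ` is a face of `σ`.) -/
def starDualGraph (F : PolyhedralFan d) (σ : PointedCone ℚ (Fin d → ℚ)) :
    SimpleGraph {α : F.MaxCone // σ ≤ α.1} where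
  Adj α β := α ≠ β ∧ ∃ τ ∈ F.cones, coneDim τ + 1 = d ∧ τ ≤ α.1.1 ∧ τ ≤ β.1.1
  symm := ⟨fun _ _ h => ⟨h.1.symm, by
    obtain ⟨τ, h1, h2, h3, h4⟩ := h.2
    exact ⟨τ, h1, h2, h4, h3⟩⟩⟩
  loopless := ⟨fun _ h => h.1 rfl⟩

/-- The fan is hereditary: the dual graph of the star of each of its faces is connected
(in particular nonempty, so that every face lies in a `d`-dimensional cone). -/
def IsHereditary (F : PolyhedralFan d) : Prop :=
  ∀ σ ∈ F.cones, (F.starDualGraph σ).Connected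

/-- A boundary facet is a `(d-1)`-dimensional cone that lies in exactly one `d`-dimensional cone. -/
def IsBoundaryFacet (F : PolyhedralFan d) (τ : PointedCone ℚ (Fin d → ℚ)) : Prop :=
  τ ∈ F.cones ∧ coneDim τ + 1 = d ∧ ∃! α : F.MaxCone, τ ≤ α.1

/-- The interior faces of dimension `i`: the `i`-dimensional cones of the fan that do not lie on
the boundary, which is the union of the boundary facets. -/
abbrev InteriorFace (F : PolyhedralFan d) (i : ℕ) : Type :=
  {σ : PointedCone ℚ (Fin d → ℚ) //
    σ ∈ F.cones ∧ coneDim σ = i ∧ ¬ ∃ τ, F.IsBoundaryFacet τ ∧ σ ≤ τ}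

instance (F : PolyhedralFan d) (i : ℕ) : Finite (F.InteriorFace i) :=
  Finite.of_injective (β := F.cones) (fun σ => ⟨σ.1, σ.2.1⟩)
    (fun _ _ h => Subtype.ext (congrArg (fun x => x.1) h))

instance (F : PolyhedralFan d) : Finite F.MaxCone :=
  Finite.of_injective (β := F.cones) (fun σ => ⟨σ.1, σ.2.1⟩)
    (fun _ _ h => Subtype.ext (congrArg (fun x => x.1) h))

noncomputable instance (F : PolyhedralFan d) (i : ℕ) : Fintype (F.InteriorFace i) :=
  Fintype.ofFinite _

/-! ### Splines -/

/-- The `S`-module `C^0(Σ)` of splines: families of polynomials, one on each `d`-dimensional cone,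
such that two polynomials on cones that share a `(d-1)`-dimensional face agree on that face. -/
noncomputable def splines (F : PolyhedralFan d) :
    Submodule (MvPolynomial (Fin d) ℚ) (F.MaxCone → MvPolynomial (Fin d) ℚ) where
  carrier := {f | ∀ α β : F.MaxCone, ∀ τ ∈ F.cones, coneDim τ + 1 = d → τ ≤ α.1 → τ ≤ β.1 →
    ∀ x ∈ τ, eval x (f α) = eval x (f β)}
  add_mem' := by
    intro f g hf hg α β τ h1 h2 h3 h4 x hx
    simp [hf α β τ h1 h2 h3 h4 x hx, hg α β τ h1 h2 h3 h4 x hx]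
  zero_mem' := by
    intro α β τ h1 h2 h3 h4 x hx
    simp
  smul_mem' := by
    intro p f hf α β τ h1 h2 h3 h4 x hx
    simp [hf α β τ h1 h2 h3 h4 x hx]

/-- The graded pieces of `C^0(Σ)`: the splines all of whose polynomials are homogeneous of
degree `k`. -/
noncomputable def splinesDeg (F : PolyhedralFan d) (k : ℕ) : Submodule ℚ F.splines :=
  (Submodule.pi Set.univ fun _ : F.MaxCone => homogeneousSubmodule (Fin d) ℚ k).comap
    (F.splines.subtype.restrictScalars ℚ)

/-! ### The cellular complex -/

/-- An orientation of every interior face: a basis of its linear span (only the orientation that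
the basis represents matters below). -/
abbrev Orienting (F : PolyhedralFan d) : Type :=
  ∀ (i : ℕ) (σ : F.InteriorFace i), Module.Basis (Fin i) ℚ (coneSpan σ.1)

open Classical in
/-- The cellular incidence number of an `(i+1)`-dimensional interior face `σ` and an
`i`-dimensional interior face `τ`. It is `0` if `τ` is not a face of `σ`. If `τ` is a face of `σ`,
it is `1` when a vector `v` of `σ` outside `τ` (that is, pointing from `τ` into `σ`) followed by
the basis of `τ` induces the orientation of `σ`, and `-1` when it induces the opposite one. -/
noncomputable def incidence (F : PolyhedralFan d) (B : F.Orienting) {i : ℕ}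
    (σ : F.InteriorFace (i + 1)) (τ : F.InteriorFace i) : ℤ :=
  if h : τ.1 ≤ σ.1 then
    if ∃ v : coneSpan σ.1, v.1 ∈ σ.1 ∧
      0 < (B (i + 1) σ).det
        (Fin.cons v fun j => Submodule.inclusion (coneSpan_mono h) (B i τ j))
    then 1 else -1
  else 0

/-- The term in degree `i` of the complex: the sum of `S / I_σ` over the interior `i`-faces `σ`. -/
def Chain (F : PolyhedralFan d) (i : ℕ) : Type :=
  ∀ σ : F.InteriorFace i, MvPolynomial (Fin d) ℚ ⧸ coneIdeal σ.1

noncomputable instance (F : PolyhedralFan d) (i : ℕ) : AddCommGroup (F.Chain i) :=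
  inferInstanceAs (AddCommGroup (∀ σ : F.InteriorFace i, MvPolynomial (Fin d) ℚ ⧸ coneIdeal σ.1))

noncomputable instance (F : PolyhedralFan d) (i : ℕ) :
    Module (MvPolynomial (Fin d) ℚ) (F.Chain i) :=
  inferInstanceAs (Module (MvPolynomial (Fin d) ℚ)
    (∀ σ : F.InteriorFace i, MvPolynomial (Fin d) ℚ ⧸ coneIdeal σ.1))

noncomputable instance (F : PolyhedralFan d) (i : ℕ) : Module ℚ (F.Chain i) :=
  inferInstanceAs (Module ℚ (∀ σ : F.InteriorFace i, MvPolynomial (Fin d) ℚ ⧸ coneIdeal σ.1))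

instance (F : PolyhedralFan d) (i : ℕ) :
    IsScalarTower ℚ (MvPolynomial (Fin d) ℚ) (F.Chain i) :=
  inferInstanceAs (IsScalarTower ℚ (MvPolynomial (Fin d) ℚ)
    (∀ σ : F.InteriorFace i, MvPolynomial (Fin d) ℚ ⧸ coneIdeal σ.1))

open Classical in
/-- The component `S / I_σ → S / I_τ` of the differential: the incidence number times the
canonical projection if `τ` is a face of `σ`, and zero otherwise. -/
noncomputable def boundaryComponent (F : PolyhedralFan d) (B : F.Orienting) {i : ℕ}
    (σ : F.InteriorFace (i + 1)) (τ : F.InteriorFace i) :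
    (MvPolynomial (Fin d) ℚ ⧸ coneIdeal σ.1) →ₗ[MvPolynomial (Fin d) ℚ]
      (MvPolynomial (Fin d) ℚ ⧸ coneIdeal τ.1) :=
  if h : τ.1 ≤ σ.1 then F.incidence B σ τ • Submodule.factor (coneIdeal_anti h) else 0

/-- The cellular differential from degree `i + 1` to degree `i`. -/
noncomputable def boundary (F : PolyhedralFan d) (B : F.Orienting) (i : ℕ) :
    F.Chain (i + 1) →ₗ[MvPolynomial (Fin d) ℚ] F.Chain i :=
  LinearMap.pi fun τ => ∑ σ, (F.boundaryComponent B σ τ).comp (LinearMap.proj σ)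

/-- The cycles of the complex, which ends in degree one: there is nothing in degree zero, and the
map out of degree one is zero. -/
noncomputable def cycles (F : PolyhedralFan d) (B : F.Orienting) :
    (i : ℕ) → Submodule (MvPolynomial (Fin d) ℚ) (F.Chain i)
  | 0 => ⊥
  | 1 => ⊤
  | i + 2 => LinearMap.ker (F.boundary B (i + 1))

/-- The homology module in degree `i`: cycles modulo boundaries. -/
abbrev Homology (F : PolyhedralFan d) (B : F.Orienting) (i : ℕ) : Type :=
  F.cycles B i ⧸ (LinearMap.range (F.boundary B i)).submoduleOf (F.cycles B i)

/-- The graded pieces of the chain modules: all components are classes of homogeneous polynomials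
of degree `k`. -/
noncomputable def chainDeg (F : PolyhedralFan d) (i k : ℕ) : Submodule ℚ (F.Chain i) :=
  Submodule.pi Set.univ fun σ : F.InteriorFace i =>
    (homogeneousSubmodule (Fin d) ℚ k).map ((coneIdeal σ.1).mkQ.restrictScalars ℚ)

/-- The graded pieces of the homology modules: the classes of cycles of degree `k`. -/
noncomputable def homologyDeg (F : PolyhedralFan d) (B : F.Orienting) (i k : ℕ) :
    Submodule ℚ (F.Homology B i) :=
  ((F.chainDeg i k).comap ((F.cycles B i).subtype.restrictScalars ℚ)).map
    (((LinearMap.range (F.boundary B i)).submoduleOf (F.cycles B i)).mkQ.restrictScalars ℚ)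

end PolyhedralFan

/-! ### Hilbert polynomials -/

/-- `P` is the Hilbert polynomial of the module with graded pieces `A k`: every piece has finite
dimension, and for all large `k` that dimension is `P(k)`. -/
def IsHilbertPolynomial {M : Type*} [AddCommGroup M] [Module ℚ M] (A : ℕ → Submodule ℚ M)
    (P : Polynomial ℚ) : Prop :=
  (∀ k, Module.Finite ℚ (A k)) ∧
    ∀ᶠ k : ℕ in atTop, P.eval (k : ℚ) = (Module.finrank ℚ (A k) : ℚ)

lemma IsHilbertPolynomial.unique {M : Type*} [AddCommGroup M] [Module ℚ M]
    {A : ℕ → Submodule ℚ M} {P Q : Polynomial ℚ} (hP : IsHilbertPolynomial A P)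
    (hQ : IsHilbertPolynomial A Q) : P = Q := by
  obtain ⟨N, hN⟩ := eventually_atTop.1 (hP.2.and hQ.2)
  refine Polynomial.eq_of_infinite_eval_eq P Q
    (((Set.Ici_infinite N).image Nat.cast_injective.injOn).mono ?_)
  rintro _ ⟨k, hk, rfl⟩
  exact (hN k hk).1.trans (hN k hk).2.symm

open Classical in
/-- The Hilbert polynomial (zero by convention if there is none). -/
noncomputable def hilbertPolynomial {M : Type*} [AddCommGroup M] [Module ℚ M]
    (A : ℕ → Submodule ℚ M) : Polynomial ℚ :=
  if h : ∃ P, IsHilbertPolynomial A P then h.choose else 0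

/-- The binomial coefficient `binom (k + n) n` as a polynomial in `k`. -/
noncomputable def binomialPoly (n : ℕ) : Polynomial ℚ :=
  Polynomial.preHilbertPoly ℚ n 0

lemma binomialPoly_eval (n k : ℕ) :
    (binomialPoly n).eval (k : ℚ) = ((k + n).choose n : ℚ) := by
  simpa [binomialPoly] using Polynomial.preHilbertPoly_eq_choose_sub_add ℚ n (Nat.zero_le k)

/-! ### Hilbert polynomials of graded modules -/

/-! In each degree k the complex consists of finite-dimensional vector spaces, so by rank–nullity
its terms and its homology have the same alternating sum of dimensions (`finrank_cycles_eq`). The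
following inputs turn this into the formula.

Terms: restriction to the span of an i-dimensional cone identifies S/I with a polynomial ring in i
variables; for i ≥ 1 its degree-k part has dimension binom(k+i-1, i-1)
(`finrank_map_mkQ_vanishingIdeal`).

Complex: if τ has codimension two in σ, the image of σ in the plane span σ / span τ is an angle with
exactly two edges. The product of the two incidence numbers through an edge is the sign of an area
form, and these signs are opposite (`sum_incidence_mul_incidence`). Cones containing an interior
face are interior, so neither edge is missing.

Top homology: after correction by orientation signs, the component of the differential at an
interior facet τ of a maximal cone is ± the difference of the polynomials on the two sides of τ.
They agree on τ exactly when this difference lies in the ideal of τ, because a cone is Zariski dense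
in its span. So splines are the kernel of the top differential (`mem_splines_iff`), degree by
degree.

Existence: the homology modules are finitely generated and graded, so Hilbert–Serre
(`GradedProj.exists_isHilbertPolynomial`) applies to them; the Euler characteristic then exhibits
the polynomial of the splines.

The complex stops in degree one, whereas `boundary` formally continues to `Chain 0`. That term lives
only in polynomial degree k = 0, which Hilbert polynomials do not see. -/

lemma Submodule.finrank_map_add_finrank_inf_ker {V W : Type*} [AddCommGroup V] [Module ℚ V]
    [AddCommGroup W] [Module ℚ W] (A : Submodule ℚ V) [Module.Finite ℚ A] (f : V →ₗ[ℚ] W) :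
    Module.finrank ℚ (A.map f) + Module.finrank ℚ (A ⊓ LinearMap.ker f : Submodule ℚ V) =
      Module.finrank ℚ A := by
  rw [← LinearMap.finrank_range_add_finrank_ker (f.domRestrict A), LinearMap.range_domRestrict]
  congr 1
  rw [← Submodule.finrank_map_subtype_eq A (LinearMap.ker (f.domRestrict A))]
  have : A ⊓ LinearMap.ker f = (LinearMap.ker (f.domRestrict A)).map A.subtype := by
    ext x
    simp [and_comm]
  rw [this]

/-- A grading of a module over a polynomial ring, given by the projections to the graded pieces. -/
structure GradedProj (σ : Type*) (M : Type*) [AddCommGroup M] [Module (MvPolynomial σ ℚ) M]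
    [Module ℚ M] where
  proj : ℕ → M →ₗ[ℚ] M
  proj_proj : ∀ j k m, proj j (proj k m) = if j = k then proj k m else 0
  proj_succ_X_smul : ∀ k i m, proj (k + 1) ((X i : MvPolynomial σ ℚ) • m) =
    (X i : MvPolynomial σ ℚ) • proj k m
  proj_zero_X_smul : ∀ i m, proj 0 ((X i : MvPolynomial σ ℚ) • m) = 0
  -- That m is the sum of its components is not required: Hilbert–Serre uses only that almost all
  -- components of an element vanish.
  eventually_proj_eq_zero : ∀ m, ∀ᶠ k in atTop, proj k m = 0

namespace GradedProj

variable {σ : Type*} {M : Type*} [AddCommGroup M] [Module (MvPolynomial σ ℚ) M]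
    [Module ℚ M]

/-- The graded piece of degree `k`. -/
def deg (G : GradedProj σ M) (k : ℕ) : Submodule ℚ M := LinearMap.range (G.proj k)

lemma mem_deg {G : GradedProj σ M} {k : ℕ} {m : M} : m ∈ G.deg k ↔ G.proj k m = m := by
  constructor
  · rintro ⟨x, rfl⟩
    simp [G.proj_proj]
  · intro h
    exact ⟨m, h⟩

variable [IsScalarTower ℚ (MvPolynomial σ ℚ) M]

/-- The grading of a homogeneous submodule. -/
noncomputable def restrict (G : GradedProj σ M) (N : Submodule (MvPolynomial σ ℚ) M)
    (h : ∀ k, ∀ m ∈ N, G.proj k m ∈ N) : GradedProj σ N where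
  proj k := (G.proj k).restrict (p := N.restrictScalars ℚ) (q := N.restrictScalars ℚ) (h k)
  proj_proj j k m := by
    apply Subtype.ext
    have := G.proj_proj j k m.1
    split_ifs at this ⊢ <;> exact this
  proj_succ_X_smul k i m := Subtype.ext (G.proj_succ_X_smul k i m.1)
  proj_zero_X_smul i m := Subtype.ext (G.proj_zero_X_smul i m.1)
  eventually_proj_eq_zero m := by
    filter_upwards [G.eventually_proj_eq_zero m.1] with k hk
    exact Subtype.ext hk

lemma map_subtype_deg (G : GradedProj σ M) (N : Submodule (MvPolynomial σ ℚ) M)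
    (h : ∀ k, ∀ m ∈ N, G.proj k m ∈ N) (k : ℕ) :
    ((G.restrict N h).deg k).map (N.subtype.restrictScalars ℚ) =
      G.deg k ⊓ N.restrictScalars ℚ := by
  ext x
  simp only [Submodule.mem_map, Submodule.mem_inf, Submodule.restrictScalars_mem, mem_deg]
  constructor
  · rintro ⟨y, hy, rfl⟩
    exact ⟨congrArg Subtype.val hy, y.2⟩
  · rintro ⟨hx, hN⟩
    exact ⟨⟨x, hN⟩, Subtype.ext hx, rfl⟩

lemma finrank_restrict_deg (G : GradedProj σ M) (N : Submodule (MvPolynomial σ ℚ) M)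
    (h : ∀ k, ∀ m ∈ N, G.proj k m ∈ N) (k : ℕ) :
    Module.finrank ℚ ((G.restrict N h).deg k) =
      Module.finrank ℚ (G.deg k ⊓ N.restrictScalars ℚ : Submodule ℚ M) := by
  rw [← map_subtype_deg G N h]
  exact LinearEquiv.finrank_eq
    (Submodule.equivMapOfInjective (N.subtype.restrictScalars ℚ) N.subtype_injective _)

/-- The grading of the quotient by a homogeneous submodule. -/
noncomputable def quotient (G : GradedProj σ M) (N : Submodule (MvPolynomial σ ℚ) M)
    (h : ∀ k, ∀ m ∈ N, G.proj k m ∈ N) : GradedProj σ (M ⧸ N) where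
  proj k := ((Submodule.Quotient.restrictScalarsEquiv ℚ N).toLinearMap ∘ₗ
    Submodule.mapQ (N.restrictScalars ℚ) (N.restrictScalars ℚ) (G.proj k) (h k)) ∘ₗ
      (Submodule.Quotient.restrictScalarsEquiv ℚ N).symm.toLinearMap
  proj_proj j k m := by
    obtain ⟨m, rfl⟩ := N.mkQ_surjective m
    have := congrArg N.mkQ (G.proj_proj j k m)
    split_ifs at this ⊢ <;> exact this
  proj_succ_X_smul k i m := by
    obtain ⟨m, rfl⟩ := N.mkQ_surjective m
    exact congrArg N.mkQ (G.proj_succ_X_smul k i m)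
  proj_zero_X_smul i m := by
    obtain ⟨m, rfl⟩ := N.mkQ_surjective m
    exact congrArg N.mkQ (G.proj_zero_X_smul i m)
  eventually_proj_eq_zero m := by
    obtain ⟨m, rfl⟩ := N.mkQ_surjective m
    filter_upwards [G.eventually_proj_eq_zero m] with k hk
    exact congrArg N.mkQ hk

lemma quotient_deg (G : GradedProj σ M) (N : Submodule (MvPolynomial σ ℚ) M)
    (h : ∀ k, ∀ m ∈ N, G.proj k m ∈ N) (k : ℕ) :
    (G.quotient N h).deg k = (G.deg k).map (N.mkQ.restrictScalars ℚ) := by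
  ext x
  constructor
  · rintro ⟨y, rfl⟩
    obtain ⟨m, rfl⟩ := N.mkQ_surjective y
    exact ⟨G.proj k m, ⟨m, rfl⟩, rfl⟩
  · rintro ⟨_, ⟨m, rfl⟩, rfl⟩
    exact ⟨N.mkQ m, rfl⟩

/-- The elements of degree `k` that are sums of multiples of variables. -/
noncomputable def varMul (G : GradedProj σ M) : ℕ → Submodule ℚ M
  | 0 => ⊥
  | k + 1 => ⨆ i : σ, (G.deg k).map
      ((LinearMap.lsmul (MvPolynomial σ ℚ) M (X i)).restrictScalars ℚ)

/-- Graded Nakayama: a polynomial is a constant plus multiples of variables, so modulo such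
multiples only the degree-k components of the generators remain. -/
lemma proj_mem_span_sup_varMul (G : GradedProj σ M) {s : Set M}
    (hs : Submodule.span (MvPolynomial σ ℚ) s = ⊤) (k : ℕ) (m : M) :
    G.proj k m ∈ Submodule.span ℚ (G.proj k '' s) ⊔ G.varMul k := by
  have hm : m ∈ Submodule.span (MvPolynomial σ ℚ) s := hs ▸ Submodule.mem_top
  induction hm using Submodule.span_induction with
  | mem x hx => exact Submodule.mem_sup_left (Submodule.subset_span ⟨x, hx, rfl⟩)
  | zero => simp
  | add x y _ _ hx hy => rw [map_add]; exact add_mem hx hy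
  | smul p x _ hx =>
    induction p using MvPolynomial.induction_on with
    | C a =>
      rw [← algebraMap_eq, algebraMap_smul, map_smul]
      exact Submodule.smul_mem _ _ hx
    | add p q hp hq => rw [add_smul, map_add]; exact add_mem hp hq
    | mul_X p i _ =>
      rw [mul_comm, mul_smul]
      refine Submodule.mem_sup_right ?_
      cases k with
      | zero => rw [G.proj_zero_X_smul]; exact zero_mem _
      | succ k =>
        rw [G.proj_succ_X_smul]
        exact Submodule.mem_iSup_of_mem i ⟨_, ⟨_, rfl⟩, rfl⟩

/-- Induction on the degree: `varMul` in degree k + 1 is a finite sum of images of the degree-k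
piece, and finitely many generators account for the rest. -/
lemma finite_deg [Finite σ] [Module.Finite (MvPolynomial σ ℚ) M] (G : GradedProj σ M) (k : ℕ) :
    Module.Finite ℚ (G.deg k) := by
  obtain ⟨s, hs⟩ := (Module.Finite.fg_top : (⊤ : Submodule (MvPolynomial σ ℚ) M).FG)
  have key : ∀ k, Module.Finite ℚ (G.varMul k) → Module.Finite ℚ (G.deg k) := by
    intro k hk
    have : Module.Finite ℚ (Submodule.span ℚ (G.proj k '' (s : Set M))) :=
      FiniteDimensional.span_of_finite ℚ ((s.finite_toSet).image _)
    refine Submodule.finiteDimensional_of_le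
      (S₂ := Submodule.span ℚ (G.proj k '' (s : Set M)) ⊔ G.varMul k) ?_
    rintro _ ⟨m, rfl⟩
    exact G.proj_mem_span_sup_varMul hs k m
  induction k with
  | zero => exact key 0 (by unfold varMul; infer_instance)
  | succ k ih => exact key (k + 1) (by unfold varMul; infer_instance)

/-- Base case of Hilbert–Serre: with `varMul` zero, a piece is spanned by components of finitely
many generators, and these vanish in large degree. -/
lemma eventually_deg_eq_bot [Module.Finite (MvPolynomial σ ℚ) M] (G : GradedProj σ M)
    (h : ∀ (i : σ) (m : M), (X i : MvPolynomial σ ℚ) • m = 0) : ∀ᶠ k in atTop, G.deg k = ⊥ := by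
  obtain ⟨s, hs⟩ := (Module.Finite.fg_top : (⊤ : Submodule (MvPolynomial σ ℚ) M).FG)
  have hv : ∀ k, G.varMul k = ⊥ := by
    intro k
    cases k with
    | zero => rfl
    | succ k =>
      rw [varMul, iSup_eq_bot]
      rintro i
      rw [eq_bot_iff]
      rintro _ ⟨m, -, rfl⟩
      exact h i m
  have : ∀ᶠ k in atTop, ∀ m ∈ s, G.proj k m = 0 :=
    (Filter.eventually_all_finset s).2 fun m _ => G.eventually_proj_eq_zero m
  filter_upwards [this] with k hk
  rw [eq_bot_iff]
  rintro _ ⟨m, rfl⟩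
  have := G.proj_mem_span_sup_varMul hs k m
  rw [hv, sup_bot_eq] at this
  refine Submodule.span_le.2 ?_ this
  rintro _ ⟨x, hx, rfl⟩
  exact hk x hx

end GradedProj

/-! ### Polynomial antidifferences -/

lemma Polynomial.exists_eval_add_one_sub_eval (P : Polynomial ℚ) :
    ∃ R : Polynomial ℚ, ∀ x : ℚ, R.eval (x + 1) - R.eval x = P.eval x := by
  induction P using Polynomial.induction_on' with
  | add p q hp hq =>
    obtain ⟨r, hr⟩ := hp
    obtain ⟨t, ht⟩ := hq
    refine ⟨r + t, fun x => ?_⟩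
    rw [Polynomial.eval_add, Polynomial.eval_add, Polynomial.eval_add, ← hr, ← ht]
    ring
  | monomial n a =>
    -- Bernoulli polynomials satisfy B_{n+1}(x+1) - B_{n+1}(x) = (n+1) xⁿ.
    refine ⟨Polynomial.C (a / (n + 1)) * Polynomial.bernoulli (n + 1), fun x => ?_⟩
    have := Polynomial.bernoulli_eval_one_add (n + 1) x
    rw [Polynomial.eval_mul, Polynomial.eval_mul, Polynomial.eval_C, add_comm x 1, this,
      Polynomial.eval_monomial]
    have h : (n + 1 : ℚ) ≠ 0 := by positivity
    have h' : a / (n + 1) * (n + 1) = a := div_mul_cancel₀ a h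
    push_cast
    rw [Polynomial.eval_C]
    linear_combination x ^ n * h'

lemma exists_polynomial_of_difference {f : ℕ → ℚ} {P : Polynomial ℚ}
    (h : ∀ᶠ k : ℕ in atTop, f (k + 1) - f k = P.eval (k : ℚ)) :
    ∃ Q : Polynomial ℚ, ∀ᶠ k : ℕ in atTop, Q.eval (k : ℚ) = f k := by
  obtain ⟨R, hR⟩ := P.exists_eval_add_one_sub_eval
  obtain ⟨N, hN⟩ := eventually_atTop.1 h
  refine ⟨R + Polynomial.C (f N - R.eval (N : ℚ)), eventually_atTop.2 ⟨N, fun k hk => ?_⟩⟩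
  induction k, hk using Nat.le_induction with
  | base => simp
  | succ k hk ih =>
    have h1 := hN k hk
    have h2 := hR k
    simp only [Polynomial.eval_add, Polynomial.eval_C, Nat.cast_add, Nat.cast_one] at ih ⊢
    linarith

namespace GradedProj

/-- Dimension count in the exact sequence 0 → K_k → M_k → M_{k+1} → (M/XM)_{k+1} → 0, whose middle
map is multiplication by X and whose first term is its kernel. -/
lemma finrank_deg_succ {σ : Type*} [Finite σ] {M : Type*} [AddCommGroup M]
    [Module (MvPolynomial σ ℚ) M] [Module ℚ M] [IsScalarTower ℚ (MvPolynomial σ ℚ) M]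
    [Module.Finite (MvPolynomial σ ℚ) M] (G : GradedProj σ M) (i : σ)
    (hK : ∀ k, ∀ m ∈ LinearMap.ker (LinearMap.lsmul (MvPolynomial σ ℚ) M (X i)),
      G.proj k m ∈ LinearMap.ker (LinearMap.lsmul (MvPolynomial σ ℚ) M (X i)))
    (hR : ∀ k, ∀ m ∈ LinearMap.range (LinearMap.lsmul (MvPolynomial σ ℚ) M (X i)),
      G.proj k m ∈ LinearMap.range (LinearMap.lsmul (MvPolynomial σ ℚ) M (X i))) (k : ℕ) :
    Module.finrank ℚ (G.deg (k + 1)) + Module.finrank ℚ ((G.restrict _ hK).deg k) =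
      Module.finrank ℚ (G.deg k) + Module.finrank ℚ ((G.quotient _ hR).deg (k + 1)) := by
  set φ := LinearMap.lsmul (MvPolynomial σ ℚ) M (X i)
  have := G.finite_deg k
  have := G.finite_deg (k + 1)
  have h1 := (G.deg k).finrank_map_add_finrank_inf_ker (φ.restrictScalars ℚ)
  have h2 := (G.deg (k + 1)).finrank_map_add_finrank_inf_ker
    ((LinearMap.range φ).mkQ.restrictScalars ℚ)
  have h3 : (G.deg (k + 1) ⊓ LinearMap.ker ((LinearMap.range φ).mkQ.restrictScalars ℚ) :
      Submodule ℚ M) = (G.deg k).map (φ.restrictScalars ℚ) := by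
    ext x
    rw [LinearMap.ker_restrictScalars, Submodule.ker_mkQ, Submodule.mem_inf, mem_deg]
    constructor
    · rintro ⟨hx, ⟨y, rfl⟩⟩
      refine ⟨G.proj k y, ⟨y, rfl⟩, ?_⟩
      rw [← hx]
      exact (G.proj_succ_X_smul k i y).symm
    · rintro ⟨_, ⟨y, rfl⟩, rfl⟩
      refine ⟨?_, ⟨_, rfl⟩⟩
      refine (G.proj_succ_X_smul k i _).trans ?_
      simp [G.proj_proj, φ]
  rw [h3] at h2
  rw [finrank_restrict_deg, quotient_deg, ← h2, ← h1, LinearMap.ker_restrictScalars]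
  ring

/-- The **Hilbert–Serre theorem**: a finitely generated graded module over a polynomial ring has a
Hilbert polynomial. -/
theorem exists_isHilbertPolynomial {σ : Type*} [Finite σ] {M : Type*} [AddCommGroup M]
    [Module (MvPolynomial σ ℚ) M] [Module ℚ M] [IsScalarTower ℚ (MvPolynomial σ ℚ) M]
    [Module.Finite (MvPolynomial σ ℚ) M] (G : GradedProj σ M) :
    ∃ P, IsHilbertPolynomial G.deg P := by
  classical
  -- Induction on a set of variables outside of which all variables act by zero, with the ring kept
  -- fixed. The kernel and cokernel of X_a are killed by X_a, so a leaves the set.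
  suffices H : ∀ s : Finset σ, ∀ (M : Type _) [AddCommGroup M]
      [Module (MvPolynomial σ ℚ) M] [Module ℚ M] [IsScalarTower ℚ (MvPolynomial σ ℚ) M]
      [Module.Finite (MvPolynomial σ ℚ) M] (G : GradedProj σ M),
      (∀ i ∉ s, ∀ m : M, (X i : MvPolynomial σ ℚ) • m = 0) →
      ∃ P : Polynomial ℚ, ∀ᶠ k : ℕ in atTop, P.eval (k : ℚ) = Module.finrank ℚ (G.deg k) by
    have := Fintype.ofFinite σ
    obtain ⟨P, hP⟩ := H Finset.univ M G (by simp)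
    exact ⟨P, G.finite_deg, hP⟩
  intro s
  induction s using Finset.induction_on with
  | empty =>
    intro M _ _ _ _ _ G h
    refine ⟨0, ?_⟩
    filter_upwards [G.eventually_deg_eq_bot fun i => h i (by simp)] with k hk
    rw [hk]
    simp
  | insert a s _ ih =>
    intro M _ _ _ _ _ G h
    set φ := LinearMap.lsmul (MvPolynomial σ ℚ) M (X a) with hφ
    have hK : ∀ k, ∀ m ∈ LinearMap.ker φ, G.proj k m ∈ LinearMap.ker φ := by
      intro k m hm
      refine (G.proj_succ_X_smul k a m).symm.trans ?_
      rw [show (X a : MvPolynomial σ ℚ) • m = 0 from hm, map_zero]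
    have hR : ∀ k, ∀ m ∈ LinearMap.range φ, G.proj k m ∈ LinearMap.range φ := by
      rintro k _ ⟨m, rfl⟩
      cases k with
      | zero => exact (G.proj_zero_X_smul a m) ▸ zero_mem _
      | succ k => exact ⟨_, (G.proj_succ_X_smul k a m).symm⟩
    obtain ⟨P, hP⟩ := ih _ (G.restrict _ hK) (by
      intro i hi m
      by_cases hia : i = a
      · subst hia
        exact Subtype.ext m.2
      · exact Subtype.ext (h i (by simp [hi, hia]) m.1))
    obtain ⟨Q, hQ⟩ := ih _ (G.quotient _ hR) (by
      intro i hi m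
      obtain ⟨m, rfl⟩ := Submodule.mkQ_surjective _ m
      rw [← map_smul]
      by_cases hia : i = a
      · subst hia
        exact (Submodule.Quotient.mk_eq_zero _).2 ⟨m, rfl⟩
      · rw [h i (by simp [hi, hia]) m, map_zero])
    -- The cokernel contributes in degree k + 1 and the kernel in degree k, whence the shift in Q
    -- alone.
    refine exists_polynomial_of_difference (P := Q.comp (Polynomial.X + 1) - P) ?_
    filter_upwards [hP, (tendsto_add_atTop_nat 1).eventually hQ] with k h1 h2
    have h3 := G.finrank_deg_succ a hK hR k
    have h4 : (Module.finrank ℚ (G.deg (k + 1)) : ℚ) +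
      Module.finrank ℚ ((G.restrict _ hK).deg k) =
      Module.finrank ℚ (G.deg k) + Module.finrank ℚ ((G.quotient _ hR).deg (k + 1)) := by
      exact_mod_cast h3
    push_cast at h2
    simp only [Polynomial.eval_sub, Polynomial.eval_comp, Polynomial.eval_add, Polynomial.eval_X,
      Polynomial.eval_one, h1, h2]
    linarith

end GradedProj

/-! ### The grading of the cellular chain modules -/

lemma MvPolynomial.homogeneousComponent_succ_X_mul {σ : Type*} (k : ℕ) (i : σ)
    (p : MvPolynomial σ ℚ) :
    homogeneousComponent (k + 1) (X i * p) = X i * homogeneousComponent k p := by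
  induction p using MvPolynomial.induction_on' with
  | monomial u a =>
    have h1 : (monomial u a : MvPolynomial σ ℚ).IsHomogeneous u.degree :=
      isHomogeneous_monomial a rfl
    have h2 : (X i * monomial u a : MvPolynomial σ ℚ).IsHomogeneous (1 + u.degree) :=
      (isHomogeneous_X ℚ i).mul h1
    rw [homogeneousComponent_of_mem h1, homogeneousComponent_of_mem h2]
    by_cases h : k = u.degree
    · rw [if_pos h, if_pos (by omega)]
    · rw [if_neg h, if_neg (by omega), mul_zero]
  | add p q hp hq => rw [mul_add, map_add, hp, hq, map_add, mul_add]

lemma MvPolynomial.homogeneousComponent_zero_X_mul {σ : Type*} (i : σ) (p : MvPolynomial σ ℚ) :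
    homogeneousComponent 0 (X i * p) = 0 := by
  rw [homogeneousComponent_zero, ← constantCoeff_eq, map_mul, constantCoeff_X, zero_mul, map_zero]

/-- The grading of the polynomial ring. -/
noncomputable def GradedProj.mvPolynomial (σ : Type*) : GradedProj σ (MvPolynomial σ ℚ) where
  proj := homogeneousComponent
  proj_proj j k m := homogeneousComponent_of_mem (homogeneousComponent_mem k m)
  proj_succ_X_smul := homogeneousComponent_succ_X_mul
  proj_zero_X_smul := homogeneousComponent_zero_X_mul
  eventually_proj_eq_zero m := by
    filter_upwards [eventually_gt_atTop m.totalDegree] with k hk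
    exact homogeneousComponent_eq_zero k m hk

lemma GradedProj.mvPolynomial_deg (σ : Type*) (k : ℕ) :
    (GradedProj.mvPolynomial σ).deg k = homogeneousSubmodule σ ℚ k := by
  ext p
  constructor
  · rintro ⟨q, rfl⟩
    exact homogeneousComponent_mem k q
  · intro hp
    exact ⟨p, homogeneousComponent_eq_self hp⟩

/-- The grading of a finite product of graded modules. -/
noncomputable def GradedProj.pi {σ ι : Type*} [Finite ι] {M : ι → Type*}
    [∀ i, AddCommGroup (M i)] [∀ i, Module (MvPolynomial σ ℚ) (M i)] [∀ i, Module ℚ (M i)]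
    (G : ∀ i, GradedProj σ (M i)) : GradedProj σ (∀ i, M i) where
  proj k := LinearMap.pi fun i => (G i).proj k ∘ₗ LinearMap.proj i
  proj_proj j k m := by
    ext i
    have := (G i).proj_proj j k (m i)
    split_ifs at this ⊢ <;> exact this
  proj_succ_X_smul k x m := by
    ext i
    exact (G i).proj_succ_X_smul k x (m i)
  proj_zero_X_smul x m := by
    ext i
    exact (G i).proj_zero_X_smul x (m i)
  eventually_proj_eq_zero m := by
    filter_upwards [Filter.eventually_all.2 fun i => (G i).eventually_proj_eq_zero (m i)] with k hk
    ext i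
    exact hk i

lemma GradedProj.pi_deg {σ ι : Type*} [Finite ι] {M : ι → Type*}
    [∀ i, AddCommGroup (M i)] [∀ i, Module (MvPolynomial σ ℚ) (M i)] [∀ i, Module ℚ (M i)]
    (G : ∀ i, GradedProj σ (M i)) (k : ℕ) :
    (GradedProj.pi G).deg k = Submodule.pi Set.univ fun i => (G i).deg k := by
  ext m
  simp only [mem_deg, Submodule.mem_pi, Set.mem_univ, true_imp_iff]
  exact funext_iff

/-! ### The coordinate ring of a linear subspace -/

section Restriction

variable {d n : ℕ} {L : Submodule ℚ (Fin d → ℚ)}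

/-- The restriction of polynomials to a linear subspace, in the coordinates given by a basis. -/
noncomputable def restrictPoly (b : Module.Basis (Fin n) ℚ L) :
    MvPolynomial (Fin d) ℚ →ₐ[ℚ] MvPolynomial (Fin n) ℚ :=
  aeval fun j => ∑ l, C ((b l).1 j) * X l

lemma eval_restrictPoly (b : Module.Basis (Fin n) ℚ L) (y : Fin n → ℚ)
    (f : MvPolynomial (Fin d) ℚ) :
    eval y (restrictPoly b f) = eval (∑ l, y l • (b l).1) f := by
  induction f using MvPolynomial.induction_on with
  | C a => simp [restrictPoly]
  | add p q hp hq => simp [hp, hq]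
  | mul_X p j hp =>
    rw [map_mul, map_mul, hp, map_mul]
    simp [restrictPoly, mul_comm]

/-- Over an infinite field a polynomial is determined by its values, and the coordinates of the
basis parametrize all of L. -/
lemma restrictPoly_eq_zero_iff (b : Module.Basis (Fin n) ℚ L) (f : MvPolynomial (Fin d) ℚ) :
    restrictPoly b f = 0 ↔ f ∈ vanishingIdeal ℚ (L : Set (Fin d → ℚ)) := by
  rw [mem_vanishingIdeal_iff]
  constructor
  · intro h x hx
    have := eval_restrictPoly b (b.repr ⟨x, hx⟩) f
    have h2 : ∑ l, b.repr ⟨x, hx⟩ l • (b l).1 = x := by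
      refine Eq.trans ?_ (congrArg L.subtype (b.sum_repr ⟨x, hx⟩))
      rw [map_sum]
      rfl
    rw [h, h2, map_zero] at this
    rw [aeval_eq_eval]
    exact this.symm
  · intro h
    refine MvPolynomial.funext fun y => ?_
    rw [eval_restrictPoly, map_zero]
    exact h _ (Submodule.sum_mem _ fun l _ => L.smul_mem _ (b l).2)

lemma isHomogeneous_restrictPoly (b : Module.Basis (Fin n) ℚ L) {f : MvPolynomial (Fin d) ℚ}
    {k : ℕ} (hf : f.IsHomogeneous k) : (restrictPoly b f).IsHomogeneous k := by
  have := hf.aeval (fun j => ∑ l, C ((b l).1 j) * X l) (n := 1)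
    fun j => IsHomogeneous.sum _ _ _ fun l _ => isHomogeneous_C_mul_X _ _
  rwa [one_mul] at this

lemma restrictPoly_homogeneousComponent (b : Module.Basis (Fin n) ℚ L) (k : ℕ)
    (f : MvPolynomial (Fin d) ℚ) :
    restrictPoly b (homogeneousComponent k f) = homogeneousComponent k (restrictPoly b f) := by
  induction f using MvPolynomial.induction_on' with
  | monomial u a =>
    have h1 : (monomial u a : MvPolynomial (Fin d) ℚ).IsHomogeneous u.degree :=
      isHomogeneous_monomial a rfl
    rw [homogeneousComponent_of_mem h1,
      homogeneousComponent_of_mem (isHomogeneous_restrictPoly b h1)]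
    split_ifs <;> simp
  | add p q hp hq => rw [map_add, map_add, hp, hq, map_add, map_add]

/-- The ideal is the kernel of a degree-preserving restriction, hence homogeneous. -/
lemma homogeneousComponent_mem_vanishingIdeal (k : ℕ) {f : MvPolynomial (Fin d) ℚ}
    (hf : f ∈ vanishingIdeal ℚ (L : Set (Fin d → ℚ))) :
    homogeneousComponent k f ∈ vanishingIdeal ℚ (L : Set (Fin d → ℚ)) := by
  have b := Module.finBasis ℚ L
  rw [← restrictPoly_eq_zero_iff b] at hf ⊢
  rw [restrictPoly_homogeneousComponent, hf, map_zero]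

lemma map_restrictPoly_homogeneousSubmodule (b : Module.Basis (Fin n) ℚ L) (k : ℕ) :
    (homogeneousSubmodule (Fin d) ℚ k).map (restrictPoly b).toLinearMap =
      homogeneousSubmodule (Fin n) ℚ k := by
  apply le_antisymm
  · rintro _ ⟨f, hf, rfl⟩
    exact isHomogeneous_restrictPoly b hf
  · intro g hg
    -- A linear retraction c of ℚ^d onto the coordinates of L: the pullback of g along c is a
    -- homogeneous preimage of g.
    obtain ⟨c, hc⟩ := ((L.subtype ∘ₗ b.equivFun.symm.toLinearMap)).exists_leftInverse_of_injective
      (LinearMap.ker_eq_bot.2 (L.subtype_injective.comp b.equivFun.symm.injective))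
    have hcb : ∀ l, c (b l).1 = Pi.single l 1 := by
      intro l
      have := LinearMap.congr_fun hc (Pi.single l 1)
      simpa using this
    have key : ∀ (y : MvPolynomial (Fin n) ℚ) (x : Fin d → ℚ),
        eval x (aeval (fun l => ∑ j, C (c (Pi.single j 1) l) * X j) y) = eval (c x) y := by
      intro y x
      have hx : ∀ l, c x l = ∑ j, c (Pi.single j 1) l * x j := by
        intro l
        conv_lhs => rw [pi_eq_sum_univ' x]
        simp [map_sum, Finset.sum_apply, mul_comm]
      induction y using MvPolynomial.induction_on with
      | C a => simp
      | add p q hp hq => rw [map_add, map_add, hp, hq, map_add]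
      | mul_X p j hp =>
        rw [map_mul, map_mul, hp, map_mul]
        simp [hx]
    refine ⟨aeval (fun l => ∑ j, C (c (Pi.single j 1) l) * X j) g, ?_, ?_⟩
    · have := IsHomogeneous.aeval (τ := Fin d) hg (fun l => ∑ j, C (c (Pi.single j 1) l) * X j)
        (n := 1) fun j => IsHomogeneous.sum _ _ _ fun l _ => isHomogeneous_C_mul_X _ _
      rwa [one_mul] at this
    · refine MvPolynomial.funext fun y => ?_
      rw [AlgHom.toLinearMap_apply, eval_restrictPoly, key, map_sum]
      congr 2
      simp only [map_smul, hcb]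
      ext l
      simp [Finset.sum_apply, Pi.single_apply]

end Restriction

lemma MvPolynomial.finrank_homogeneousSubmodule (n k : ℕ) :
    Module.finrank ℚ (homogeneousSubmodule (Fin n) ℚ k) = (n + k - 1).choose k := by
  have h : homogeneousSubmodule (Fin n) ℚ k = restrictSupport ℚ {u | u.degree = k} :=
    homogeneousSubmodule_eq_finsupp_supported _ _ k
  have e : {u : Fin n →₀ ℕ | u.degree = k} =
      ((Finset.univ.finsuppAntidiag k : Finset (Fin n →₀ ℕ)) : Set (Fin n →₀ ℕ)) := by
    ext u
    simp [Finsupp.degree_eq_sum]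
  rw [h, Module.finrank_eq_nat_card_basis (basisRestrictSupport ℚ _), Nat.card_coe_set_eq, e,
    Set.ncard_coe_finset, Finset.card_finsuppAntidiag_nat_eq_choose, Finset.card_univ,
    Fintype.card_fin]

/-- The quotient map and `restrictPoly` have the same kernel, so the images of the degree-k
polynomials have the same dimension. Dimension n + 1 keeps the binomial free of subtraction. -/
lemma finrank_map_mkQ_vanishingIdeal {d n : ℕ} {L : Submodule ℚ (Fin d → ℚ)}
    (b : Module.Basis (Fin (n + 1)) ℚ L) (k : ℕ) :
    Module.finrank ℚ ((homogeneousSubmodule (Fin d) ℚ k).map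
      ((vanishingIdeal ℚ (L : Set (Fin d → ℚ))).mkQ.restrictScalars ℚ)) = (k + n).choose n := by
  have : Module.Finite ℚ (homogeneousSubmodule (Fin d) ℚ k) :=
    Module.Finite.iff_fg.2 (homogeneousSubmodule_fg _ _ k)
  have h1 := (homogeneousSubmodule (Fin d) ℚ k).finrank_map_add_finrank_inf_ker
    ((vanishingIdeal ℚ (L : Set (Fin d → ℚ))).mkQ.restrictScalars ℚ)
  have h2 := (homogeneousSubmodule (Fin d) ℚ k).finrank_map_add_finrank_inf_ker
    (restrictPoly b).toLinearMap
  have h3 : LinearMap.ker (restrictPoly b).toLinearMap =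
      LinearMap.ker ((vanishingIdeal ℚ (L : Set (Fin d → ℚ))).mkQ.restrictScalars ℚ) := by
    ext f
    rw [LinearMap.ker_restrictScalars, Submodule.ker_mkQ]
    exact restrictPoly_eq_zero_iff b f
  rw [h3, map_restrictPoly_homogeneousSubmodule, finrank_homogeneousSubmodule] at h2
  rw [show (k + n).choose n = (n + 1 + k - 1).choose k by
    rw [show n + 1 + k - 1 = k + n by omega, Nat.choose_symm_add]]
  omega

/-! ### Graded pieces of the chain modules -/

namespace PolyhedralFan

variable {d : ℕ}

/-- The grading of the chain modules. -/
noncomputable def chainGrading (F : PolyhedralFan d) (i : ℕ) : GradedProj (Fin d) (F.Chain i) :=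
  GradedProj.pi (M := fun σ : F.InteriorFace i => MvPolynomial (Fin d) ℚ ⧸ coneIdeal σ.1)
    fun σ => (GradedProj.mvPolynomial (Fin d)).quotient (coneIdeal σ.1)
      fun k _ hm => homogeneousComponent_mem_vanishingIdeal k hm

lemma chainGrading_deg (F : PolyhedralFan d) (i k : ℕ) :
    (F.chainGrading i).deg k = F.chainDeg i k := by
  refine (GradedProj.pi_deg _ k).trans ?_
  refine congrArg (Submodule.pi Set.univ) (funext fun σ => ?_)
  refine (GradedProj.quotient_deg _ _ _ k).trans ?_
  rw [GradedProj.mvPolynomial_deg]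

instance (F : PolyhedralFan d) (i : ℕ) : Module.Finite (MvPolynomial (Fin d) ℚ) (F.Chain i) :=
  inferInstanceAs (Module.Finite (MvPolynomial (Fin d) ℚ)
    (∀ σ : F.InteriorFace i, MvPolynomial (Fin d) ℚ ⧸ coneIdeal σ.1))

/-- The dimension of a product of submodules is the sum of their dimensions. -/
lemma _root_.Submodule.finrank_pi_univ {ι : Type*} [Fintype ι] {M : ι → Type*}
    [∀ i, AddCommGroup (M i)] [∀ i, Module ℚ (M i)] (A : ∀ i, Submodule ℚ (M i))
    [∀ i, Module.Finite ℚ (A i)] :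
    Module.finrank ℚ (Submodule.pi Set.univ A) = ∑ i, Module.finrank ℚ (A i) := by
  rw [← Module.finrank_pi_fintype]
  exact LinearEquiv.finrank_eq
    { toFun := fun x i => ⟨x.1 i, x.2 i trivial⟩
      invFun := fun y => ⟨fun i => (y i).1, fun i _ => (y i).2⟩
      map_add' := fun _ _ => rfl
      map_smul' := fun _ _ => rfl
      left_inv := fun _ => rfl
      right_inv := fun _ => rfl }

lemma finrank_chainDeg_succ (F : PolyhedralFan d) (B : F.Orienting) (i k : ℕ) :
    Module.finrank ℚ (F.chainDeg (i + 1) k) =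
      Fintype.card (F.InteriorFace (i + 1)) * (k + i).choose i := by
  have : Module.Finite ℚ (homogeneousSubmodule (Fin d) ℚ k) :=
    Module.Finite.iff_fg.2 (homogeneousSubmodule_fg _ _ k)
  refine (Submodule.finrank_pi_univ _).trans ?_
  refine (Finset.sum_congr rfl fun σ _ => finrank_map_mkQ_vanishingIdeal (B (i + 1) σ) k).trans ?_
  simp

/-- A zero-dimensional cone spans only the origin, where forms of positive degree vanish. This makes
the formal degree-zero term harmless. -/
lemma chainDeg_zero_succ (F : PolyhedralFan d) (k : ℕ) : F.chainDeg 0 (k + 1) = ⊥ := by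
  rw [eq_bot_iff]
  intro x hx
  refine funext fun σ => ?_
  obtain ⟨p, hp, hpx⟩ := hx σ trivial
  rw [← hpx]
  refine (Submodule.Quotient.mk_eq_zero _).2 ?_
  intro y hy
  have h0 : coneSpan σ.1 = ⊥ := Submodule.finrank_eq_zero.1 σ.2.2.1
  have hy0 : y = 0 := by
    have : y ∈ coneSpan σ.1 := hy
    rwa [h0] at this
  have hp' : p.IsHomogeneous (k + 1) := hp
  rw [hy0]
  refine (RingHom.congr_fun MvPolynomial.eval_zero p).trans ?_
  exact hp'.coeff_eq_zero (by simp)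

end PolyhedralFan

/-! ### Faces of cones -/

section Cones

variable {d : ℕ} {σ τ : PointedCone ℚ (Fin d → ℚ)}

lemma subset_coneSpan {x : Fin d → ℚ} (hx : x ∈ σ) : x ∈ coneSpan σ := Submodule.subset_span hx

lemma exists_sub_of_mem_coneSpan {x : Fin d → ℚ} (hx : x ∈ coneSpan σ) :
    ∃ a ∈ σ, ∃ b ∈ σ, x = a - b := by
  induction hx using Submodule.span_induction with
  | mem x hx => exact ⟨x, hx, 0, zero_mem _, by simp⟩
  | zero => exact ⟨0, zero_mem _, 0, zero_mem _, by simp⟩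
  | add x y _ _ hx hy =>
    obtain ⟨a, ha, b, hb, rfl⟩ := hx
    obtain ⟨a', ha', b', hb', rfl⟩ := hy
    exact ⟨a + a', add_mem ha ha', b + b', add_mem hb hb', by abel⟩
  | smul r x _ hx =>
    obtain ⟨a, ha, b, hb, rfl⟩ := hx
    rcases le_total 0 r with hr | hr
    · exact ⟨r • a, PointedCone.smul_mem _ hr ha, r • b,
        PointedCone.smul_mem _ hr hb, smul_sub _ _ _⟩
    · exact ⟨(-r) • b, PointedCone.smul_mem _ (by linarith) hb, (-r) • a,
        PointedCone.smul_mem _ (by linarith) ha, by module⟩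

/-- Write x = a - b with a, b in τ; then x + b lies in the face, which forces x into it. So a face
is the cone cut with the span of the face. -/
lemma PointedCone.IsFaceOf.mem_of_mem_coneSpan (h : τ.IsFaceOf σ) {x : Fin d → ℚ} (hx : x ∈ σ)
    (hxτ : x ∈ coneSpan τ) : x ∈ τ := by
  obtain ⟨a, ha, b, hb, rfl⟩ := exists_sub_of_mem_coneSpan hxτ
  refine h.mem_of_add_mem_left hx (h.le hb) ?_
  rwa [sub_add_cancel]

lemma PointedCone.IsFaceOf.mem_of_add_mem_coneSpan (h : τ.IsFaceOf σ) {x y : Fin d → ℚ}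
    (hx : x ∈ σ) (hy : y ∈ σ) (hxy : x + y ∈ coneSpan τ) : x ∈ τ :=
  h.mem_of_add_mem_left hx hy (h.mem_of_mem_coneSpan (add_mem hx hy) hxy)

lemma PointedCone.IsFaceOf.eq_of_coneSpan_eq {ρ : PointedCone ℚ (Fin d → ℚ)} (h : τ.IsFaceOf σ)
    (h' : ρ.IsFaceOf σ) (e : coneSpan τ = coneSpan ρ) : τ = ρ := by
  apply le_antisymm
  · intro x hx
    exact h'.mem_of_mem_coneSpan (h.le hx) (e ▸ subset_coneSpan hx)
  · intro x hx
    exact h.mem_of_mem_coneSpan (h'.le hx) (e ▸ subset_coneSpan hx)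

lemma PointedCone.IsFaceOf.eq_of_coneDim_le (h : τ.IsFaceOf σ) (e : coneDim σ ≤ coneDim τ) :
    τ = σ :=
  h.eq_of_coneSpan_eq .rfl (Submodule.eq_of_le_of_finrank_le (coneSpan_mono h.le) e)

lemma exists_mem_notMem_of_coneDim_lt (h : coneDim τ < coneDim σ) :
    ∃ v ∈ σ, v ∉ coneSpan τ := by
  by_contra! H
  have : coneSpan σ ≤ coneSpan τ := Submodule.span_le.2 H
  exact absurd (Submodule.finrank_mono this) (not_le.2 h)

/-- A linear form on the span of a cone whose kernel is spanned by a face has constant sign. -/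
lemma PointedCone.IsFaceOf.same_sign (h : τ.IsFaceOf σ) (l : (Fin d → ℚ) →ₗ[ℚ] ℚ)
    (h0 : ∀ v ∈ τ, l v = 0) (h1 : ∀ v ∈ coneSpan σ, l v = 0 → v ∈ coneSpan τ)
    {u w : Fin d → ℚ} (hu : u ∈ σ) (hw : w ∈ σ) (hlu : l u < 0) (hlw : 0 < l w) : False := by
  -- This positive combination is killed by l, so it lies in the face; then u does too, although l u
  -- < 0.
  have hm : l w • u + (-l u) • w ∈ coneSpan τ := by
    refine h1 _ (add_mem ((coneSpan σ).smul_mem _ (subset_coneSpan hu))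
      ((coneSpan σ).smul_mem _ (subset_coneSpan hw))) ?_
    simp
    ring
  have hs := h.mem_of_mem_coneSpan (add_mem (PointedCone.smul_mem _ hlw.le hu)
    (PointedCone.smul_mem _ (by linarith : 0 ≤ -l u) hw)) hm
  have := h.mem_of_smul_add_smul_mem_left hu hw hlw (by linarith) hs
  exact absurd (h0 u this) hlu.ne

/-- A bilinear form on the span of a cone that comes from a volume form on its two-dimensional
quotient by the span of a face. -/
structure IsAreaForm (σ τ : PointedCone ℚ (Fin d → ℚ))
    (ω : (Fin d → ℚ) →ₗ[ℚ] (Fin d → ℚ) →ₗ[ℚ] ℚ) : Prop where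
  self : ∀ u, ω u u = 0
  right : ∀ u, ∀ t ∈ coneSpan τ, ω u t = 0
  exists_smul : ∀ u ∈ coneSpan σ, ∀ w ∈ coneSpan σ, w ∉ coneSpan τ → ω u w = 0 →
    ∃ r : ℚ, u - r • w ∈ coneSpan τ

namespace IsAreaForm

variable {ω : (Fin d → ℚ) →ₗ[ℚ] (Fin d → ℚ) →ₗ[ℚ] ℚ}

lemma neg (h : IsAreaForm σ τ ω) : IsAreaForm σ τ (-ω) where
  self u := by simp [h.self]
  right u t ht := by simp [h.right u t ht]
  exists_smul u hu w hw hwt h0 := h.exists_smul u hu w hw hwt (by simpa using h0)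

lemma swap (h : IsAreaForm σ τ ω) (u w : Fin d → ℚ) : ω u w = -ω w u := by
  have := h.self (u + w)
  simp only [map_add, LinearMap.add_apply, h.self] at this
  linarith

lemma left (h : IsAreaForm σ τ ω) (u : Fin d → ℚ) {t : Fin d → ℚ} (ht : t ∈ coneSpan τ) :
    ω t u = 0 := by
  rw [h.swap, h.right u t ht, neg_zero]

/-- Modulo τ the vectors of σ fill an angle that contains no line, so the order "counterclockwise
of" cannot cycle. -/
lemma trans (h : IsAreaForm σ τ ω) (hf : τ.IsFaceOf σ) {u w z : Fin d → ℚ} (hu : u ∈ σ)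
    (hw : w ∈ σ) (hz : z ∈ σ) (hut : u ∉ coneSpan τ) (hwt : w ∉ coneSpan τ) (h1 : 0 ≤ ω u w)
    (h2 : 0 ≤ ω w z) : 0 ≤ ω u z := by
  by_contra! h3
  have h4 : 0 < ω z u := by rw [h.swap]; linarith
  -- Cramer's relation among three vectors of a plane: y vanishes modulo span τ. Its coefficients
  -- are nonnegative and that of w is positive, so the face property would put w in span τ.
  set y := ω z u • w + (ω u w • z + ω w z • u) with hy
  have hyσ : y ∈ coneSpan σ := add_mem (Submodule.smul_mem _ _ (subset_coneSpan hw))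
    (add_mem (Submodule.smul_mem _ _ (subset_coneSpan hz))
      (Submodule.smul_mem _ _ (subset_coneSpan hu)))
  have hyu : ω y u = 0 := by
    simp [hy, h.self, h.swap w u]
    ring
  have hyz : ω y z = 0 := by
    simp [hy, h.self, h.swap u z]
    ring
  obtain ⟨r, hr⟩ := h.exists_smul y hyσ u (subset_coneSpan hu) hut hyu
  have hr0 : r = 0 := by
    have := h.left z hr
    simp only [map_sub, map_smul, LinearMap.sub_apply, LinearMap.smul_apply, hyz,
      smul_eq_mul] at this
    rcases mul_eq_zero.1 (by linarith : r * ω u z = 0) with h | h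
    · exact h
    · linarith
  rw [hr0, zero_smul, sub_zero] at hr
  have := hf.mem_of_add_mem_coneSpan (PointedCone.smul_mem _ h4.le hw)
    (add_mem (PointedCone.smul_mem _ h1 hz) (PointedCone.smul_mem _ h2 hu)) hr
  refine hwt ?_
  have := (coneSpan τ).smul_mem (ω z u)⁻¹ (subset_coneSpan this)
  rwa [smul_smul, inv_mul_cancel₀ h4.ne', one_smul] at this

/-- By `trans`, the finitely many generators outside span τ have an extreme one. The inequality
extends to σ by nonnegative combinations. -/
lemma exists_extremal (h : IsAreaForm σ τ ω) (hf : τ.IsFaceOf σ) (hfg : Submodule.FG σ)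
    (hne : ∃ v ∈ σ, v ∉ coneSpan τ) :
    ∃ w ∈ σ, w ∉ coneSpan τ ∧ ∀ u ∈ σ, 0 ≤ ω u w := by
  classical
  obtain ⟨S, hS⟩ := hfg
  have hSσ : ∀ s ∈ S, s ∈ σ := fun s hs => hS ▸ Submodule.subset_span hs
  have key : ∀ T : Finset (Fin d → ℚ), T.Nonempty → (∀ t ∈ T, t ∈ σ ∧ t ∉ coneSpan τ) →
      ∃ w ∈ T, ∀ u ∈ T, 0 ≤ ω u w := by
    intro T hT
    induction hT using Finset.Nonempty.cons_induction with
    | singleton a =>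
      intro _
      exact ⟨a, by simp, by simp [h.self]⟩
    | cons a T haT hT ih =>
      intro H
      obtain ⟨w, hw, hmax⟩ := ih fun t ht => H t (by simp [ht])
      rcases le_or_gt 0 (ω a w) with haw | haw
      · refine ⟨w, by simp [hw], fun u hu => ?_⟩
        rcases Finset.mem_cons.1 hu with rfl | hu
        · exact haw
        · exact hmax u hu
      · have hwa : 0 ≤ ω w a := by rw [h.swap]; linarith
        refine ⟨a, by simp, fun u hu => ?_⟩
        rcases Finset.mem_cons.1 hu with rfl | hu
        · rw [h.self]
        · have hu' := H u (by simp [hu])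
          have hw' := H w (by simp [hw])
          have ha' := H a (by simp)
          exact h.trans hf hu'.1 hw'.1 ha'.1 hu'.2 hw'.2 (hmax u hu) hwa
  have hTne : (S.filter (· ∉ coneSpan τ)).Nonempty := by
    by_contra hemp
    rw [Finset.not_nonempty_iff_eq_empty, Finset.filter_eq_empty_iff] at hemp
    obtain ⟨v, hv, hvt⟩ := hne
    have : σ ≤ τ := by
      rw [← hS]
      exact Submodule.span_le.2 fun s hs =>
        hf.mem_of_mem_coneSpan (hSσ s hs) (not_not.1 (hemp hs))
    exact hvt (subset_coneSpan (this hv))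
  obtain ⟨w, hw, hmax⟩ := key _ hTne fun t ht =>
    ⟨hSσ t (Finset.mem_filter.1 ht).1, (Finset.mem_filter.1 ht).2⟩
  refine ⟨w, hSσ w (Finset.mem_filter.1 hw).1, (Finset.mem_filter.1 hw).2, fun u hu => ?_⟩
  rw [← hS] at hu
  induction hu using Submodule.span_induction with
  | mem x hx =>
    by_cases hxt : x ∈ coneSpan τ
    · rw [h.left w hxt]
    · exact hmax x (Finset.mem_filter.2 ⟨hx, hxt⟩)
  | zero => simp
  | add x y _ _ hx hy =>
    rw [map_add, LinearMap.add_apply]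
    exact add_nonneg hx hy
  | smul r x _ hx =>
    change 0 ≤ ω ((r : ℚ) • x) w
    rw [map_smul, LinearMap.smul_apply]
    exact mul_nonneg r.2 hx

/-- A cone between `τ` and `σ` that lies on the positive extreme of the angle `σ / τ`. -/
def IsPositive (σ τ : PointedCone ℚ (Fin d → ℚ)) (ω : (Fin d → ℚ) →ₗ[ℚ] (Fin d → ℚ) →ₗ[ℚ] ℚ)
    (ρ : PointedCone ℚ (Fin d → ℚ)) : Prop :=
  ∃ w ∈ ρ, w ∉ coneSpan τ ∧ ∃ u ∈ σ, 0 < ω u w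

lemma coneSpan_eq_sup {ρ : PointedCone ℚ (Fin d → ℚ)} (hτρ : τ ≤ ρ)
    (hd : coneDim ρ = coneDim τ + 1) {w : Fin d → ℚ} (hw : w ∈ ρ) (hwt : w ∉ coneSpan τ) :
    coneSpan ρ = coneSpan τ ⊔ Submodule.span ℚ {w} := by
  refine (Submodule.eq_of_le_of_finrank_eq (sup_le (coneSpan_mono hτρ) ?_) ?_).symm
  · rw [Submodule.span_singleton_le_iff_mem]
    exact subset_coneSpan hw
  · rw [Submodule.finrank_sup_span_singleton hwt]
    exact hd.symm

lemma form_eq_zero (h : IsAreaForm σ τ ω) {w x : Fin d → ℚ}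
    (hx : x ∈ coneSpan τ ⊔ Submodule.span ℚ {w}) : ω x w = 0 := by
  obtain ⟨t, ht, y, hy, rfl⟩ := Submodule.mem_sup.1 hx
  obtain ⟨r, rfl⟩ := Submodule.mem_span_singleton.1 hy
  simp [h.self, h.left w ht]

lemma mem_sup_of_form_eq_zero (h : IsAreaForm σ τ ω) {w x : Fin d → ℚ} (hw : w ∈ coneSpan σ)
    (hx : x ∈ coneSpan σ) (hwt : w ∉ coneSpan τ) (h0 : ω x w = 0) :
    x ∈ coneSpan τ ⊔ Submodule.span ℚ {w} := by
  obtain ⟨r, hr⟩ := h.exists_smul x hx w hw hwt h0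
  rw [← sub_add_cancel x (r • w)]
  exact Submodule.add_mem_sup hr (Submodule.mem_span_singleton.2 ⟨r, rfl⟩)

lemma exists_pos (h : IsAreaForm σ τ ω) (hd : coneDim σ = coneDim τ + 2) {w : Fin d → ℚ}
    (hw : w ∈ σ) (hwt : w ∉ coneSpan τ) (hmax : ∀ u ∈ σ, 0 ≤ ω u w) : ∃ u ∈ σ, 0 < ω u w := by
  by_contra! H
  have h0 : coneSpan σ ≤ coneSpan τ ⊔ Submodule.span ℚ {w} := Submodule.span_le.2 fun u hu =>
    h.mem_sup_of_form_eq_zero (subset_coneSpan hw) (subset_coneSpan hu) hwt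
      (le_antisymm (H u hu) (hmax u hu))
  have := Submodule.finrank_mono h0
  rw [Submodule.finrank_sup_span_singleton hwt] at this
  unfold coneDim at hd
  omega

lemma exists_isPositive (h : IsAreaForm σ τ ω) (hf : τ.IsFaceOf σ) (hfg : Submodule.FG σ)
    (hd : coneDim σ = coneDim τ + 2) :
    ∃ ρ : PointedCone ℚ (Fin d → ℚ), ρ.IsFaceOf σ ∧ τ ≤ ρ ∧ coneDim ρ = coneDim τ + 1 ∧
      IsPositive σ τ ω ρ := by
  obtain ⟨w, hw, hwt, hmax⟩ := h.exists_extremal hf hfg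
    (exists_mem_notMem_of_coneDim_lt (by omega))
  -- The edge is cut out by the supporting hyperplane ω(·, w) = 0.
  let ρ : PointedCone ℚ (Fin d → ℚ) := σ ⊓ (LinearMap.ker (ω.flip w)).restrictScalars _
  have hρ : ∀ x, x ∈ ρ ↔ x ∈ σ ∧ ω x w = 0 := fun x => Iff.rfl
  have hτρ : τ ≤ ρ := fun x hx => (hρ x).2 ⟨hf.le hx, h.left w (subset_coneSpan hx)⟩
  have hwρ : w ∈ ρ := (hρ w).2 ⟨hw, h.self w⟩
  refine ⟨ρ, ⟨inf_le_left, ?_⟩, hτρ, ?_, w, hwρ, hwt, h.exists_pos hd hw hwt hmax⟩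
  · intro x y a hx hy ha hxy
    refine (hρ x).2 ⟨hx, ?_⟩
    have := ((hρ _).1 hxy).2
    rw [map_add, map_smul, LinearMap.add_apply, LinearMap.smul_apply, smul_eq_mul] at this
    have h1 := hmax x hx
    have h2 := hmax y hy
    have h3 := mul_nonneg ha.le h1
    exact (mul_eq_zero.1 (by linarith : a * ω x w = 0)).resolve_left ha.ne'
  · have : coneSpan ρ = coneSpan τ ⊔ Submodule.span ℚ {w} := by
      refine le_antisymm (Submodule.span_le.2 fun x hx => ?_) (sup_le (coneSpan_mono hτρ) ?_)
      · exact h.mem_sup_of_form_eq_zero (subset_coneSpan hw) (subset_coneSpan hx.1) hwt hx.2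
      · rw [Submodule.span_singleton_le_iff_mem]
        exact subset_coneSpan hwρ
    rw [coneDim, this, Submodule.finrank_sup_span_singleton hwt, coneDim]

/-- On span σ the kernel of ω(·, w) is the span of the face ρ, so `same_sign` lets a single positive
value decide all signs. -/
lemma nonneg_of_isPositive (h : IsAreaForm σ τ ω) {ρ : PointedCone ℚ (Fin d → ℚ)}
    (hρσ : ρ.IsFaceOf σ) (hτρ : τ ≤ ρ) (hd : coneDim ρ = coneDim τ + 1) {w : Fin d → ℚ}
    (hw : w ∈ ρ) (hwt : w ∉ coneSpan τ) {u : Fin d → ℚ} (hu : u ∈ σ) (hpos : 0 < ω u w) :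
    ∀ u ∈ σ, 0 ≤ ω u w := by
  intro v hv
  by_contra! hlt
  have e := coneSpan_eq_sup hτρ hd hw hwt
  refine hρσ.same_sign (ω.flip w) (fun x hx => h.form_eq_zero (e ▸ subset_coneSpan hx))
    (fun x hx h0 => ?_) hv hu hlt hpos
  rw [e]
  exact h.mem_sup_of_form_eq_zero (subset_coneSpan (hρσ.le hw)) hx hwt h0

/-- Extremality of both vectors gives ω(w', w) ≥ 0 and ≤ 0; hence they are proportional modulo τ,
and faces with equal spans coincide. -/
lemma eq_of_isPositive (h : IsAreaForm σ τ ω) {ρ ρ' : PointedCone ℚ (Fin d → ℚ)}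
    (hρσ : ρ.IsFaceOf σ) (hτρ : τ ≤ ρ) (hd : coneDim ρ = coneDim τ + 1)
    (hρσ' : ρ'.IsFaceOf σ) (hτρ' : τ ≤ ρ') (hd' : coneDim ρ' = coneDim τ + 1)
    (hP : IsPositive σ τ ω ρ) (hP' : IsPositive σ τ ω ρ') : ρ = ρ' := by
  obtain ⟨w, hw, hwt, u, hu, hpos⟩ := hP
  obtain ⟨w', hw', hwt', u', hu', hpos'⟩ := hP'
  have h1 := h.nonneg_of_isPositive hρσ hτρ hd hw hwt hu hpos w' (hρσ'.le hw')
  have h2 := h.nonneg_of_isPositive hρσ' hτρ' hd' hw' hwt' hu' hpos' w (hρσ.le hw)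
  have h0 : ω w' w = 0 := by
    rw [h.swap] at h2
    linarith
  have hmem := h.mem_sup_of_form_eq_zero (subset_coneSpan (hρσ.le hw))
    (subset_coneSpan (hρσ'.le hw')) hwt h0
  have e := coneSpan_eq_sup hτρ hd hw hwt
  have e' := coneSpan_eq_sup hτρ' hd' hw' hwt'
  refine (hρσ'.eq_of_coneSpan_eq hρσ (Submodule.eq_of_le_of_finrank_eq ?_ (hd'.trans hd.symm))).symm
  rw [e, e']
  refine sup_le le_sup_left ?_
  rw [Submodule.span_singleton_le_iff_mem]
  exact hmem

/-- Opposite signs would give w' = t + r w with r < 0 and t in span τ; then w' - r w is in span τ,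
and the face property puts w' there. Thus the two edges of the angle are distinct. -/
lemma not_isPositive_neg (h : IsAreaForm σ τ ω) {ρ : PointedCone ℚ (Fin d → ℚ)}
    (hρσ : ρ.IsFaceOf σ) (hτρ : τ ≤ ρ) (hd : coneDim ρ = coneDim τ + 1)
    (hf : τ.IsFaceOf σ) (hP : IsPositive σ τ ω ρ) : ¬ IsPositive σ τ (-ω) ρ := by
  rintro ⟨w', hw', hwt', u', hu', hpos'⟩
  obtain ⟨w, hw, hwt, u, hu, hpos⟩ := hP
  have e := coneSpan_eq_sup hτρ hd hw hwt
  have hw'' : w' ∈ coneSpan τ ⊔ Submodule.span ℚ {w} := e ▸ subset_coneSpan hw'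
  obtain ⟨t, ht, y, hy, rfl⟩ := Submodule.mem_sup.1 hw''
  obtain ⟨r, rfl⟩ := Submodule.mem_span_singleton.1 hy
  have hn := h.nonneg_of_isPositive hρσ hτρ hd hw hwt hu hpos u' hu'
  have hr : r < 0 := by
    simp only [LinearMap.neg_apply, map_add, map_smul, h.right u' t ht, smul_eq_mul] at hpos'
    by_contra! hr
    have := mul_nonneg hr hn
    linarith
  refine hwt' (subset_coneSpan (hf.mem_of_add_mem_coneSpan (hρσ.le hw')
    (PointedCone.smul_mem _ (by linarith : 0 ≤ -r) (hρσ.le hw)) ?_))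
  rwa [add_assoc, neg_smul, add_neg_cancel, add_zero]

end IsAreaForm

end Cones

/-! ### Incidence numbers -/

section VolumeForm

variable {E : Type*} [AddCommGroup E] [Module ℚ E]

/-- An extension to the whole space of the determinant with respect to a basis of a subspace. -/
noncomputable def volForm {n : ℕ} {W : Submodule ℚ E} (b : Module.Basis (Fin n) ℚ W) :
    E [⋀^Fin n]→ₗ[ℚ] ℚ :=
  b.det.compLinearMap (W.subtype.exists_leftInverse_of_injective W.ker_subtype).choose

variable {n : ℕ} {U W : Submodule ℚ E}

lemma volForm_coe (b : Module.Basis (Fin n) ℚ W) (v : Fin n → W) :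
    volForm b (fun j => (v j : E)) = b.det v := by
  have h := (W.subtype.exists_leftInverse_of_injective W.ker_subtype).choose_spec
  rw [volForm, AlternatingMap.compLinearMap_apply]
  congr 1
  ext j
  exact congrArg Subtype.val (LinearMap.congr_fun h (v j))

lemma volForm_ne_zero (b : Module.Basis (Fin n) ℚ W) {v : Fin n → E} (hv : ∀ j, v j ∈ W)
    (hli : LinearIndependent ℚ v) : volForm b v ≠ 0 := by
  have := Module.Finite.of_basis b
  have hli' : LinearIndependent ℚ fun j => (⟨v j, hv j⟩ : W) :=
    LinearIndependent.of_comp W.subtype hli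
  have h := volForm_coe b fun j => (⟨v j, hv j⟩ : W)
  rw [h]
  have hspan := hli'.span_eq_top_of_card_eq_finrank' (Module.finrank_eq_card_basis b).symm
  exact ((Module.Basis.is_basis_iff_det b).1 ⟨hli', hspan⟩).ne_zero

/-- Alternating forms of top degree on W form a line; this is the source of every product formula
for signs below. -/
lemma AlternatingMap.eq_mul_volForm (f : E [⋀^Fin n]→ₗ[ℚ] ℚ) (b : Module.Basis (Fin n) ℚ W)
    {v : Fin n → E} (hv : ∀ j, v j ∈ W) : f v = f (fun j => (b j : E)) * volForm b v := by
  have := congrArg (fun g => g fun j => (⟨v j, hv j⟩ : W))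
    ((f.compLinearMap W.subtype).eq_smul_basis_det b)
  have h := volForm_coe b fun j => (⟨v j, hv j⟩ : W)
  rw [h]
  exact this

/-- The linear form on the span of a cone that defines a facet, in terms of bases. -/
noncomputable def facetForm (b : Module.Basis (Fin (n + 1)) ℚ W) (c : Module.Basis (Fin n) ℚ U) :
    E →ₗ[ℚ] ℚ where
  toFun v := (volForm b).curryLeft v fun j => (c j : E)
  map_add' u v := by rw [map_add, AlternatingMap.add_apply]
  map_smul' r v := by rw [map_smul, AlternatingMap.smul_apply, RingHom.id_apply]

lemma facetForm_apply (b : Module.Basis (Fin (n + 1)) ℚ W) (c : Module.Basis (Fin n) ℚ U) (v : E) :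
    facetForm b c v = volForm b (Fin.cons v fun j => (c j : E)) := rfl

lemma linearIndependent_coe_basis (c : Module.Basis (Fin n) ℚ U) :
    LinearIndependent ℚ fun j => (c j : E) :=
  c.linearIndependent.map' U.subtype U.ker_subtype

lemma span_range_coe_basis (c : Module.Basis (Fin n) ℚ U) :
    Submodule.span ℚ (Set.range fun j => (c j : E)) = U := by
  have : (Set.range fun j => (c j : E)) = U.subtype '' Set.range c := by
    rw [← Set.range_comp]
    rfl
  rw [this, Submodule.span_image, c.span_eq, Submodule.map_subtype_top]

lemma facetForm_eq_zero (b : Module.Basis (Fin (n + 1)) ℚ W) (c : Module.Basis (Fin n) ℚ U) {v : E}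
    (hv : v ∈ U) : facetForm b c v = 0 := by
  rw [facetForm_apply]
  refine AlternatingMap.map_linearDependent _ _ fun h => ?_
  have := (linearIndependent_finCons.1 h).2
  rw [span_range_coe_basis] at this
  exact this hv

lemma facetForm_ne_zero (hUW : U ≤ W) (b : Module.Basis (Fin (n + 1)) ℚ W)
    (c : Module.Basis (Fin n) ℚ U) {v : E} (hv : v ∈ W) (hvU : v ∉ U) : facetForm b c v ≠ 0 := by
  rw [facetForm_apply]
  refine volForm_ne_zero b (Fin.cases hv fun j => hUW (c j).2) (linearIndependent_finCons.2 ⟨?_, ?_⟩)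
  · exact linearIndependent_coe_basis c
  · rwa [span_range_coe_basis]

/-- The bilinear form on the span of a cone that vanishes on a face of codimension two, in terms of
bases. -/
noncomputable def areaForm (b : Module.Basis (Fin (n + 2)) ℚ W) (c : Module.Basis (Fin n) ℚ U) :
    E →ₗ[ℚ] E →ₗ[ℚ] ℚ :=
  LinearMap.mk₂ ℚ (fun u w => ((volForm b).curryLeft u).curryLeft w fun j => (c j : E))
    (fun _ _ _ => by simp only [map_add, AlternatingMap.curryLeft_add, LinearMap.add_apply,
      AlternatingMap.add_apply])
    (fun _ _ _ => by simp only [map_smul, AlternatingMap.curryLeft_smul, LinearMap.smul_apply,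
      AlternatingMap.smul_apply])
    (fun _ _ _ => by simp only [map_add, AlternatingMap.add_apply])
    (fun _ _ _ => by simp only [map_smul, AlternatingMap.smul_apply])

lemma areaForm_apply (b : Module.Basis (Fin (n + 2)) ℚ W) (c : Module.Basis (Fin n) ℚ U) (u w : E) :
    areaForm b c u w = volForm b (Fin.cons u (Fin.cons w fun j => (c j : E))) := rfl

/-- Contracting the volume form of W with u leaves a top form on V, a multiple of the volume form of
the basis r; evaluation at r gives the factor. -/
lemma areaForm_eq_mul {V : Submodule ℚ E} (hUV : U ≤ V) (b : Module.Basis (Fin (n + 2)) ℚ W)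
    (r : Module.Basis (Fin (n + 1)) ℚ V) (c : Module.Basis (Fin n) ℚ U) (u : E) {w : E}
    (hw : w ∈ V) : areaForm b c u w = facetForm b r u * facetForm r c w :=
  ((volForm b).curryLeft u).eq_mul_volForm r (Fin.cases hw fun j => hUV (c j).2)

end VolumeForm

lemma isAreaForm_areaForm {d n : ℕ} {σ τ : PointedCone ℚ (Fin d → ℚ)} (hτσ : τ ≤ σ)
    (b : Module.Basis (Fin (n + 2)) ℚ (coneSpan σ)) (c : Module.Basis (Fin n) ℚ (coneSpan τ)) :
    IsAreaForm σ τ (areaForm b c) where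
  self u := by
    rw [areaForm_apply]
    exact AlternatingMap.map_eq_zero_of_eq _ _ (i := 0) (j := 1) rfl (by simp)
  right u t ht := by
    rw [areaForm_apply]
    refine AlternatingMap.map_linearDependent _ _ fun h => ?_
    have := (linearIndependent_finCons.1 (linearIndependent_finCons.1 h).1).2
    rw [span_range_coe_basis] at this
    exact this ht
  exists_smul u hu w hw hwt h0 := by
    by_contra H
    refine volForm_ne_zero b (Fin.cases hu (Fin.cases hw fun j => coneSpan_mono hτσ (c j).2)) ?_ h0
    refine linearIndependent_finCons.2 ⟨linearIndependent_finCons.2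
      ⟨linearIndependent_coe_basis c, ?_⟩, ?_⟩
    · rwa [span_range_coe_basis]
    · rw [Fin.range_cons, Submodule.mem_span_insert]
      rintro ⟨r, z, hz, rfl⟩
      rw [span_range_coe_basis] at hz
      exact H ⟨r, by rwa [add_sub_cancel_left]⟩

/-! ### Incidence numbers in a fan -/

namespace PolyhedralFan

variable {d : ℕ} (F : PolyhedralFan d) (B : F.Orienting)

lemma isFaceOf_of_le {σ τ : PointedCone ℚ (Fin d → ℚ)} (hσ : σ ∈ F.cones) (hτ : τ ∈ F.cones)
    (h : τ ≤ σ) : τ.IsFaceOf σ := by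
  have := F.inter_face σ hσ τ hτ
  rwa [inf_eq_right.2 h] at this

/-- The incidence number is the sign of the facet form at any vector of the cone off the facet. -/
lemma incidence_eq_sign {i : ℕ} {σ : F.InteriorFace (i + 1)} {τ : F.InteriorFace i}
    (h : τ.1 ≤ σ.1) {v : Fin d → ℚ} (hv : v ∈ σ.1) (hvt : v ∉ coneSpan τ.1) :
    F.incidence B σ τ = (SignType.sign (facetForm (B (i + 1) σ) (B i τ) v) : ℤ) := by
  have hdet : ∀ w : coneSpan σ.1, (B (i + 1) σ).det
      (Fin.cons w fun j => Submodule.inclusion (coneSpan_mono h) (B i τ j)) =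
      facetForm (B (i + 1) σ) (B i τ) w := by
    intro w
    rw [facetForm_apply, ← volForm_coe]
    congr 1
    ext j
    refine Fin.cases ?_ (fun j => ?_) j <;> rfl
  have hface := F.isFaceOf_of_le σ.2.1 τ.2.1 h
  have hne := facetForm_ne_zero (coneSpan_mono h) (B (i + 1) σ) (B i τ) (subset_coneSpan hv) hvt
  unfold incidence
  rw [dif_pos h]
  split_ifs with hex
  · obtain ⟨w, hw, hpos⟩ := hex
    replace hpos := hpos.trans_eq (hdet w)
    have : 0 < facetForm (B (i + 1) σ) (B i τ) v := by
      refine lt_of_le_of_ne (not_lt.1 fun hlt => ?_) hne.symm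
      refine hface.same_sign _ (fun x hx => facetForm_eq_zero _ _ (subset_coneSpan hx))
        (fun x hx h0 => ?_) hv hw hlt hpos
      by_contra hxt
      exact facetForm_ne_zero (coneSpan_mono h) _ _ hx hxt h0
    rw [sign_pos this]
    rfl
  · have : facetForm (B (i + 1) σ) (B i τ) v < 0 := by
      refine lt_of_le_of_ne (not_lt.1 fun hlt => ?_) hne
      exact hex ⟨⟨v, subset_coneSpan hv⟩, hv, hlt.trans_eq (hdet ⟨v, subset_coneSpan hv⟩).symm⟩
    rw [sign_neg this]
    rfl

lemma incidence_of_not_le {i : ℕ} {σ : F.InteriorFace (i + 1)} {τ : F.InteriorFace i}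
    (h : ¬ τ.1 ≤ σ.1) : F.incidence B σ τ = 0 := dif_neg h

/-- The orientation of the intermediate face enters both factors and cancels, leaving a sign that
depends only on σ, τ and the side. -/
lemma incidence_mul_incidence {i : ℕ} {σ : F.InteriorFace (i + 2)} {ρ : F.InteriorFace (i + 1)}
    {τ : F.InteriorFace i} (h1 : τ.1 ≤ ρ.1) (h2 : ρ.1 ≤ σ.1) {u w : Fin d → ℚ} (hu : u ∈ σ.1)
    (hw : w ∈ ρ.1) (hne : areaForm (B (i + 2) σ) (B i τ) u w ≠ 0) :
    F.incidence B σ ρ * F.incidence B ρ τ =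
      (SignType.sign (areaForm (B (i + 2) σ) (B i τ) u w) : ℤ) := by
  rw [areaForm_eq_mul (coneSpan_mono h1) _ (B (i + 1) ρ) _ u (subset_coneSpan hw)] at hne ⊢
  rw [F.incidence_eq_sign B h2 hu fun h => hne (by rw [facetForm_eq_zero _ _ h, zero_mul]),
    F.incidence_eq_sign B h1 hw fun h => hne (by rw [facetForm_eq_zero _ _ h, mul_zero]), sign_mul]
  push_cast
  rfl

/-- A cone of the fan that contains an interior face is an interior face. -/
lemma not_le_boundary_of_le {τ ρ : PointedCone ℚ (Fin d → ℚ)}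
    (hτ : ¬ ∃ φ, F.IsBoundaryFacet φ ∧ τ ≤ φ) (h : τ ≤ ρ) : ¬ ∃ φ, F.IsBoundaryFacet φ ∧ ρ ≤ φ :=
  fun ⟨φ, h1, h2⟩ => hτ ⟨φ, h1, h.trans h2⟩

/-- The two faces between a face and a face of codimension two contribute opposite signs. -/
lemma sum_incidence_mul_incidence {i : ℕ} (σ : F.InteriorFace (i + 2)) (τ : F.InteriorFace i)
    (h : τ.1 ≤ σ.1) : ∑ ρ, F.incidence B σ ρ * F.incidence B ρ τ = 0 := by
  set ω := areaForm (B (i + 2) σ) (B i τ) with hω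
  have hA : IsAreaForm σ.1 τ.1 ω := isAreaForm_areaForm h _ _
  have hf := F.isFaceOf_of_le σ.2.1 τ.2.1 h
  have hd : coneDim σ.1 = coneDim τ.1 + 2 := by rw [σ.2.2.1, τ.2.2.1]
  have hfg := F.fg σ.1 σ.2.1
  -- The edges of the angle σ / τ are the positive edges for ω and for -ω.
  obtain ⟨ρ₁, hf₁, hτ₁, hd₁, hP₁⟩ := hA.exists_isPositive hf hfg hd
  obtain ⟨ρ₂, hf₂, hτ₂, hd₂, hP₂⟩ := hA.neg.exists_isPositive hf hfg hd
  have hne : ρ₁ ≠ ρ₂ := by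
    rintro rfl
    exact hA.not_isPositive_neg hf₁ hτ₁ hd₁ hf hP₁ hP₂
  let r₁ : F.InteriorFace (i + 1) := ⟨ρ₁, F.face_mem _ σ.2.1 _ hf₁, by rw [hd₁, τ.2.2.1],
    F.not_le_boundary_of_le τ.2.2.2 hτ₁⟩
  let r₂ : F.InteriorFace (i + 1) := ⟨ρ₂, F.face_mem _ σ.2.1 _ hf₂, by rw [hd₂, τ.2.2.1],
    F.not_le_boundary_of_le τ.2.2.2 hτ₂⟩
  have h₁ : F.incidence B σ r₁ * F.incidence B r₁ τ = 1 := by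
    obtain ⟨w, hw, -, u, hu, hpos⟩ := hP₁
    rw [F.incidence_mul_incidence B (ρ := r₁) hτ₁ hf₁.le hu hw hpos.ne', sign_pos hpos]
    rfl
  have h₂ : F.incidence B σ r₂ * F.incidence B r₂ τ = -1 := by
    obtain ⟨w, hw, -, u, hu, hpos⟩ := hP₂
    have hneg : ω u w < 0 := by simpa using hpos
    rw [F.incidence_mul_incidence B (ρ := r₂) hτ₂ hf₂.le hu hw hneg.ne, sign_neg hneg]
    rfl
  rw [Fintype.sum_eq_add r₁ r₂ (fun e => hne (congrArg Subtype.val e)), h₁, h₂, add_neg_cancel]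
  rintro ρ ⟨hn₁, hn₂⟩
  by_cases hρσ : ρ.1 ≤ σ.1
  swap
  · rw [F.incidence_of_not_le B hρσ, zero_mul]
  by_cases hτρ : τ.1 ≤ ρ.1
  swap
  · rw [F.incidence_of_not_le B hτρ, mul_zero]
  exfalso
  have hρf := F.isFaceOf_of_le σ.2.1 ρ.2.1 hρσ
  have hρd : coneDim ρ.1 = coneDim τ.1 + 1 := by rw [ρ.2.2.1, τ.2.2.1]
  obtain ⟨w, hw, hwt⟩ := exists_mem_notMem_of_coneDim_lt (σ := ρ.1) (τ := τ.1) (by omega)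
  obtain ⟨u, hu, hut⟩ := exists_mem_notMem_of_coneDim_lt (σ := σ.1) (τ := ρ.1) (by omega)
  -- Any intermediate face has a definite sign, and uniqueness of the positive edge identifies it
  -- with one of the two already found.
  have h0 : ω u w ≠ 0 := by
    intro h0
    refine hut ?_
    rw [IsAreaForm.coneSpan_eq_sup hτρ hρd hw hwt]
    exact hA.mem_sup_of_form_eq_zero (subset_coneSpan (hρσ hw)) (subset_coneSpan hu) hwt h0
  rcases lt_or_gt_of_ne h0 with hlt | hgt
  · exact hn₂ (Subtype.ext (hA.neg.eq_of_isPositive hρf hτρ hρd hf₂ hτ₂ hd₂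
      ⟨w, hw, hwt, u, hu, by simpa using hlt⟩ hP₂))
  · exact hn₁ (Subtype.ext (hA.eq_of_isPositive hρf hτρ hρd hf₁ hτ₁ hd₁
      ⟨w, hw, hwt, u, hu, hgt⟩ hP₁))

/-! ### The square of the differential -/

lemma boundary_apply {i : ℕ} (x : F.Chain (i + 1)) (τ : F.InteriorFace i) :
    F.boundary B i x τ = ∑ σ, F.boundaryComponent B σ τ (x σ) := by
  unfold boundary
  refine (LinearMap.sum_apply _ _ _).trans ?_
  rfl

lemma boundaryComponent_mk {i : ℕ} (σ : F.InteriorFace (i + 1)) (τ : F.InteriorFace i)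
    (p : MvPolynomial (Fin d) ℚ) :
    F.boundaryComponent B σ τ ((coneIdeal σ.1).mkQ p) =
      F.incidence B σ τ • (coneIdeal τ.1).mkQ p := by
  unfold boundaryComponent
  split_ifs with h
  · rfl
  · rw [F.incidence_of_not_le B h, zero_smul]
    rfl

/-- On polynomial representatives, the coefficient at τ of the polynomial on σ is the sum of
incidence products over intermediate faces. -/
lemma boundary_comp_boundary (i : ℕ) : F.boundary B i ∘ₗ F.boundary B (i + 1) = 0 := by
  refine LinearMap.ext fun x => funext fun τ => ?_
  have hp : ∀ σ, ∃ p, (coneIdeal σ.1).mkQ p = x σ := fun σ => Submodule.mkQ_surjective _ (x σ)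
  choose p hp using hp
  have h1 : ∀ ρ, F.boundary B (i + 1) x ρ =
      (coneIdeal ρ.1).mkQ (∑ σ, F.incidence B σ ρ • p σ) := by
    intro ρ
    rw [boundary_apply, map_sum]
    refine Finset.sum_congr rfl fun σ _ => ?_
    rw [← hp, boundaryComponent_mk, map_zsmul]
  refine (F.boundary_apply B _ τ).trans ?_
  have h2 : ∀ ρ : F.InteriorFace (i + 1),
      F.boundaryComponent B ρ τ (F.boundary B (i + 1) x ρ) =
        (coneIdeal τ.1).mkQ (∑ σ, (F.incidence B σ ρ * F.incidence B ρ τ) • p σ) := by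
    intro ρ
    rw [h1, boundaryComponent_mk, ← map_zsmul, Finset.smul_sum]
    congr 1
    refine Finset.sum_congr rfl fun σ _ => ?_
    rw [smul_smul, mul_comm]
  rw [Finset.sum_congr rfl fun ρ _ => h2 ρ, ← map_sum, Finset.sum_comm]
  have h3 : ∑ σ, ∑ ρ, (F.incidence B σ ρ * F.incidence B ρ τ) • p σ = 0 := by
    refine Finset.sum_eq_zero fun σ _ => ?_
    rw [← Finset.sum_smul]
    by_cases h : τ.1 ≤ σ.1
    · rw [F.sum_incidence_mul_incidence B σ τ h, zero_smul]
    · rw [Finset.sum_eq_zero, zero_smul]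
      intro ρ _
      by_cases hτρ : τ.1 ≤ ρ.1
      · rw [F.incidence_of_not_le B fun hρσ => h (hτρ.trans hρσ), zero_mul]
      · rw [F.incidence_of_not_le B hτρ, mul_zero]
  rw [h3, map_zero]
  rfl

end PolyhedralFan

/-! ### Splines as top-dimensional cycles -/

/-- For a point a - b of the span, p vanishes on the ray a + t b, t ≥ 0, inside the cone. As a
polynomial in t it is zero, in particular at t = -1. -/
lemma mem_coneIdeal_of_eval_eq_zero {d : ℕ} {τ : PointedCone ℚ (Fin d → ℚ)}
    {p : MvPolynomial (Fin d) ℚ} (h : ∀ x ∈ τ, eval x p = 0) : p ∈ coneIdeal τ := by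
  intro x hx
  obtain ⟨a, ha, b, hb, rfl⟩ := exists_sub_of_mem_coneSpan hx
  let g : MvPolynomial (Fin d) ℚ →ₐ[ℚ] Polynomial ℚ :=
    aeval fun j => Polynomial.C (a j) + Polynomial.C (b j) * Polynomial.X
  have key : ∀ (p : MvPolynomial (Fin d) ℚ) (t : ℚ), (g p).eval t = eval (a + t • b) p := by
    intro p t
    induction p using MvPolynomial.induction_on with
    | C r => simp [g]
    | add p q hp hq => rw [map_add, Polynomial.eval_add, hp, hq, map_add]
    | mul_X p j hp =>
      have hj : g (X j) = Polynomial.C (a j) + Polynomial.C (b j) * Polynomial.X := aeval_X _ _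
      rw [map_mul, Polynomial.eval_mul, hp, map_mul, hj, eval_X]
      simp only [Polynomial.eval_add, Polynomial.eval_mul, Polynomial.eval_C, Polynomial.eval_X,
        Pi.add_apply, Pi.smul_apply, smul_eq_mul, mul_comm]
  have h0 : g p = 0 := by
    refine Polynomial.eq_of_infinite_eval_eq (g p) 0
      ((Set.infinite_range_of_injective (Nat.cast_injective (R := ℚ))).mono ?_)
    rintro _ ⟨m, rfl⟩
    change (g p).eval (m : ℚ) = Polynomial.eval (m : ℚ) 0
    rw [key, Polynomial.eval_zero]
    exact h _ (add_mem ha (PointedCone.smul_mem _ (Nat.cast_nonneg m) hb))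
  have h1 := key p (-1)
  rw [h0, Polynomial.eval_zero] at h1
  rw [aeval_eq_eval]
  change eval (a - b) p = 0
  rw [h1]
  congr 2
  module

namespace PolyhedralFan

section Top

variable {n : ℕ} (F : PolyhedralFan (n + 1)) (B : F.Orienting)

/-- An interior face of maximal dimension as a maximal cone. -/
def InteriorFace.toMaxCone {F : PolyhedralFan (n + 1)} (σ : F.InteriorFace (n + 1)) : F.MaxCone :=
  ⟨σ.1, σ.2.1, σ.2.2.1⟩

/-- A maximal cone as an interior face. -/
def MaxCone.toInteriorFace {F : PolyhedralFan (n + 1)} (α : F.MaxCone) : F.InteriorFace (n + 1) :=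
  ⟨α.1, α.2.1, α.2.2, by
    rintro ⟨φ, ⟨-, h, -⟩, hle⟩
    have := Submodule.finrank_mono (coneSpan_mono hle)
    have := α.2.2
    unfold coneDim at *
    omega⟩

lemma coneSpan_eq_top {σ : PointedCone ℚ (Fin (n + 1) → ℚ)} (h : coneDim σ = n + 1) :
    coneSpan σ = ⊤ :=
  Submodule.eq_top_of_finrank_eq (by rw [Module.finrank_fin_fun]; exact h)

/-- Maximal cones on the same side of a common facet are equal. -/
lemma eq_of_same_side {α β τ : PointedCone ℚ (Fin (n + 1) → ℚ)} (hα : α ∈ F.cones)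
    (hβ : β ∈ F.cones) (hαd : coneDim α = n + 1) (hβd : coneDim β = n + 1)
    (hτd : coneDim τ = n) (hτα : τ ≤ α) (hτβ : τ ≤ β) {v v' : Fin (n + 1) → ℚ} (hv : v ∈ α)
    (hv' : v' ∈ β) (hvt : v ∉ coneSpan τ) {r : ℚ} (hr : 0 < r) (h : v - r • v' ∈ coneSpan τ) :
    α = β := by
  obtain ⟨t₁, h₁, t₂, h₂, e⟩ := exists_sub_of_mem_coneSpan h
  -- Translation by t₂ moves v to a point of both cones off span τ, so the intersection, a face of
  -- each, is full-dimensional.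
  have hz : v + t₂ ∈ α ⊓ β := by
    refine ⟨add_mem hv (hτα h₂), ?_⟩
    have : v + t₂ = r • v' + t₁ := by
      rw [← sub_eq_iff_eq_add'] at *
      rw [add_sub_right_comm, e]
      abel
    rw [this]
    exact add_mem (PointedCone.smul_mem _ hr.le hv') (hτβ h₁)
  have hzt : v + t₂ ∉ coneSpan τ := fun hz' =>
    hvt (by simpa using sub_mem hz' (subset_coneSpan h₂))
  have hle : coneSpan τ ⊔ Submodule.span ℚ {v + t₂} ≤ coneSpan (α ⊓ β) := by
    refine sup_le (coneSpan_mono (le_inf hτα hτβ)) ?_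
    rw [Submodule.span_singleton_le_iff_mem]
    exact subset_coneSpan hz
  have hfr := Submodule.finrank_mono hle
  rw [Submodule.finrank_sup_span_singleton hzt] at hfr
  have hdim : n + 1 ≤ coneDim (α ⊓ β) := by
    unfold coneDim at *
    omega
  have h1 := (F.inter_face α hα β hβ).eq_of_coneDim_le (hαd.trans_le hdim)
  have h2 := (F.inter_face β hβ α hα).eq_of_coneDim_le (hβd.trans_le (inf_comm α β ▸ hdim))
  exact h1.symm.trans ((inf_comm α β).trans h2)

/-- The standard basis of the whole space. -/
noncomputable def topBasis (n : ℕ) : Module.Basis (Fin n) ℚ (⊤ : Submodule ℚ (Fin n → ℚ)) :=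
  (Pi.basisFun ℚ (Fin n)).map Submodule.topEquiv.symm

/-- The orientation of a maximal cone relative to the standard one. -/
noncomputable def relOrientation (σ : F.InteriorFace (n + 1)) : ℚ :=
  volForm (B (n + 1) σ) fun j => (topBasis (n + 1) j : Fin (n + 1) → ℚ)

lemma relOrientation_ne_zero (σ : F.InteriorFace (n + 1)) : F.relOrientation B σ ≠ 0 :=
  volForm_ne_zero _ (fun j => by rw [coneSpan_eq_top σ.2.2.1]; trivial)
    (linearIndependent_coe_basis _)

/-- The sign of the orientation of a maximal cone. -/
noncomputable def orientationSign (σ : F.InteriorFace (n + 1)) : ℤ :=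
  (SignType.sign (F.relOrientation B σ) : ℤ)

lemma coe_sign_mul_self {x : ℚ} (hx : x ≠ 0) :
    (SignType.sign x : ℤ) * (SignType.sign x : ℤ) = 1 := by
  rcases lt_or_gt_of_ne hx with h | h
  · rw [sign_neg h]
    rfl
  · rw [sign_pos h]
    rfl

lemma orientationSign_mul_self (σ : F.InteriorFace (n + 1)) :
    F.orientationSign B σ * F.orientationSign B σ = 1 :=
  coe_sign_mul_self (F.relOrientation_ne_zero B σ)

/-- Measured against the standard orientation, the incidence number records only the side of τ on
which σ lies. -/
lemma incidence_mul_orientationSign (σ : F.InteriorFace (n + 1)) (τ : F.InteriorFace n)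
    (h : τ.1 ≤ σ.1) {v : Fin (n + 1) → ℚ} (hv : v ∈ σ.1) (hvt : v ∉ coneSpan τ.1) :
    F.incidence B σ τ * F.orientationSign B σ =
      (SignType.sign (facetForm (topBasis (n + 1)) (B n τ) v) : ℤ) := by
  have e : facetForm (B (n + 1) σ) (B n τ) v =
      F.relOrientation B σ * facetForm (topBasis (n + 1)) (B n τ) v :=
    (volForm (B (n + 1) σ)).eq_mul_volForm (topBasis (n + 1)) fun _ => trivial
  rw [F.incidence_eq_sign B h hv hvt, e, sign_mul]
  push_cast
  rw [mul_right_comm]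
  change F.orientationSign B σ * F.orientationSign B σ * _ = _
  rw [orientationSign_mul_self, one_mul]

lemma incidence_mul_orientationSign_mul_self (σ : F.InteriorFace (n + 1)) (τ : F.InteriorFace n)
    (h : τ.1 ≤ σ.1) :
    (F.incidence B σ τ * F.orientationSign B σ) * (F.incidence B σ τ * F.orientationSign B σ) =
      1 := by
  obtain ⟨v, hv, hvt⟩ := exists_mem_notMem_of_coneDim_lt (σ := σ.1) (τ := τ.1)
    (by rw [σ.2.2.1, τ.2.2.1]; omega)
  rw [F.incidence_mul_orientationSign B σ τ h hv hvt]
  exact coe_sign_mul_self (facetForm_ne_zero le_top _ _ trivial hvt)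

lemma incidence_mul_orientationSign_opposite {σ σ' : F.InteriorFace (n + 1)}
    (τ : F.InteriorFace n) (hne : σ ≠ σ') (h : τ.1 ≤ σ.1) (h' : τ.1 ≤ σ'.1) :
    F.incidence B σ' τ * F.orientationSign B σ' =
      -(F.incidence B σ τ * F.orientationSign B σ) := by
  obtain ⟨v, hv, hvt⟩ := exists_mem_notMem_of_coneDim_lt (σ := σ.1) (τ := τ.1)
    (by rw [σ.2.2.1, τ.2.2.1]; omega)
  obtain ⟨v', hv', hvt'⟩ := exists_mem_notMem_of_coneDim_lt (σ := σ'.1) (τ := τ.1)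
    (by rw [σ'.2.2.1, τ.2.2.1]; omega)
  rw [F.incidence_mul_orientationSign B σ τ h hv hvt,
    F.incidence_mul_orientationSign B σ' τ h' hv' hvt']
  set l := facetForm (topBasis (n + 1)) (B n τ)
  have hl : l v ≠ 0 := facetForm_ne_zero le_top _ _ trivial hvt
  have hl' : l v' ≠ 0 := facetForm_ne_zero le_top _ _ trivial hvt'
  -- With r = l v / l v' the vector v - r v' lies in span τ, so a positive ratio would put both
  -- cones on the same side.
  have hside : ¬ 0 < l v / l v' := by
    intro hr
    refine hne (Subtype.ext (F.eq_of_same_side σ.2.1 σ'.2.1 σ.2.2.1 σ'.2.2.1 τ.2.2.1 h h'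
      hv hv' hvt hr ?_))
    by_contra hmem
    refine facetForm_ne_zero le_top (topBasis (n + 1)) (B n τ) trivial hmem ?_
    change l _ = 0
    rw [map_sub, map_smul, smul_eq_mul, div_mul_cancel₀ _ hl', sub_self]
  rcases lt_or_gt_of_ne hl with h1 | h1 <;> rcases lt_or_gt_of_ne hl' with h2 | h2
  · exact absurd (div_pos_of_neg_of_neg h1 h2) hside
  · rw [sign_neg h1, sign_pos h2]
    rfl
  · rw [sign_pos h1, sign_neg h2]
    rfl
  · exact absurd (div_pos h1 h2) hside

lemma sum_incidence_smul {σ σ' : F.InteriorFace (n + 1)} (τ : F.InteriorFace n) (hne : σ ≠ σ')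
    (h : τ.1 ≤ σ.1) (h' : τ.1 ≤ σ'.1)
    (f : F.InteriorFace (n + 1) → MvPolynomial (Fin (n + 1)) ℚ) :
    ∑ ρ, (F.incidence B ρ τ * F.orientationSign B ρ) • f ρ =
      (F.incidence B σ τ * F.orientationSign B σ) • (f σ - f σ') := by
  rw [Fintype.sum_eq_add σ σ' hne, F.incidence_mul_orientationSign_opposite B τ hne h h', neg_smul,
    smul_sub, sub_eq_add_neg]
  rintro ρ ⟨hρ, hρ'⟩
  by_cases hτρ : τ.1 ≤ ρ.1
  -- There are only two sides: three pairwise opposite integers are all zero.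
  · have h1 := F.incidence_mul_orientationSign_opposite B τ hne h h'
    have h2 := F.incidence_mul_orientationSign_opposite B τ hρ hτρ h
    have h3 := F.incidence_mul_orientationSign_opposite B τ hρ' hτρ h'
    rw [show F.incidence B ρ τ * F.orientationSign B ρ = 0 by omega, zero_smul]
  · rw [F.incidence_of_not_le B hτρ, zero_mul, zero_smul]

/-- Families of polynomials on the maximal cones as chains, with signs that make up for the
orientations. -/
noncomputable def toChain :
    (F.MaxCone → MvPolynomial (Fin (n + 1)) ℚ) →ₗ[ℚ] F.Chain (n + 1) where
  toFun f := fun σ => (coneIdeal σ.1).mkQ (F.orientationSign B σ • f σ.toMaxCone)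
  map_add' f g := funext fun σ => by
    rw [Pi.add_apply, smul_add, map_add]
    rfl
  map_smul' r f := funext fun σ => by
    rw [Pi.smul_apply, smul_comm]
    rfl

lemma boundary_toChain (f : F.MaxCone → MvPolynomial (Fin (n + 1)) ℚ) (τ : F.InteriorFace n) :
    F.boundary B n (F.toChain B f) τ = (coneIdeal τ.1).mkQ
      (∑ ρ, (F.incidence B ρ τ * F.orientationSign B ρ) • f ρ.toMaxCone) := by
  rw [boundary_apply, map_sum]
  refine Finset.sum_congr rfl fun σ _ => ?_
  refine (F.boundaryComponent_mk B σ τ _).trans ?_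
  rw [← map_zsmul, smul_smul]

lemma mem_splines_iff (f : F.MaxCone → MvPolynomial (Fin (n + 1)) ℚ) :
    f ∈ F.splines ↔ F.boundary B n (F.toChain B f) = 0 := by
  constructor
  · intro hf
    refine funext fun τ => ?_
    rw [boundary_toChain]
    refine (Submodule.Quotient.mk_eq_zero _).2 ?_
    by_cases hex : ∃ σ : F.InteriorFace (n + 1), τ.1 ≤ σ.1
    · obtain ⟨σ, hσ⟩ := hex
      obtain ⟨σ', hσ', hne⟩ : ∃ σ' : F.InteriorFace (n + 1), τ.1 ≤ σ'.1 ∧ σ ≠ σ' := by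
        -- If σ were the only maximal cone at τ, then τ would be a boundary facet.
        by_contra! H
        refine τ.2.2.2 ⟨τ.1, ⟨τ.2.1, by rw [τ.2.2.1], σ.toMaxCone, hσ, fun α hα => ?_⟩, le_rfl⟩
        exact Subtype.ext (congrArg (fun x => x.1) (H α.toInteriorFace hα)).symm
      rw [F.sum_incidence_smul B τ hne hσ hσ' fun ρ => f ρ.toMaxCone]
      refine zsmul_mem (mem_coneIdeal_of_eval_eq_zero fun x hx => ?_) _
      rw [map_sub, hf σ.toMaxCone σ'.toMaxCone τ.1 τ.2.1 (by rw [τ.2.2.1]) hσ hσ' x hx, sub_self]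
    · push Not at hex
      rw [Finset.sum_eq_zero]
      · exact zero_mem _
      · intro ρ _
        rw [F.incidence_of_not_le B (hex ρ), zero_mul, zero_smul]
  · intro h α β τ hτ hd hα hβ x hx
    by_cases hαβ : α = β
    · rw [hαβ]
    have hτd : coneDim τ = n := by omega
    -- A boundary facet containing τ has the same dimension and so equals τ, but τ lies in two
    -- maximal cones.
    let t : F.InteriorFace n := ⟨τ, hτ, hτd, by
      rintro ⟨φ, ⟨hφ, hφd, γ, -, huniq⟩, hle⟩
      have hφτ := (F.isFaceOf_of_le hφ hτ hle).eq_of_coneDim_le (by omega)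
      rw [← hφτ] at huniq
      exact hαβ ((huniq α hα).trans (huniq β hβ).symm)⟩
    have hne : α.toInteriorFace ≠ β.toInteriorFace := fun e =>
      hαβ (Subtype.ext (congrArg (fun x => x.1) e))
    have h0 := congrFun h t
    rw [boundary_toChain, F.sum_incidence_smul B t hne hα hβ fun ρ => f ρ.toMaxCone] at h0
    have h1 := zsmul_mem ((Submodule.Quotient.mk_eq_zero _).1 h0)
      (F.incidence B α.toInteriorFace t * F.orientationSign B α.toInteriorFace)
    rw [smul_smul, F.incidence_mul_orientationSign_mul_self B _ t hα, one_smul] at h1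
    have h2 := h1 x (subset_coneSpan hx)
    rw [aeval_eq_eval] at h2
    change eval x (f α - f β) = 0 at h2
    rwa [map_sub, sub_eq_zero] at h2

/-- A maximal cone spans the whole space, so its ideal is zero. -/
lemma toChain_injective : Function.Injective (F.toChain B) := by
  rw [injective_iff_map_eq_zero]
  intro f hf
  refine funext fun α => ?_
  have h0 := congrFun hf α.toInteriorFace
  have h1 := zsmul_mem ((Submodule.Quotient.mk_eq_zero _).1 h0)
    (F.orientationSign B α.toInteriorFace)
  rw [smul_smul, orientationSign_mul_self, one_smul] at h1
  refine MvPolynomial.funext fun x => ?_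
  have h2 := h1 x (by
    change x ∈ coneSpan α.1
    rw [coneSpan_eq_top α.2.2]
    trivial)
  rw [aeval_eq_eval] at h2
  rw [Pi.zero_apply, map_zero]
  exact h2

lemma map_toChain_splinesDeg (k : ℕ) :
    (F.splinesDeg k).map (F.toChain B ∘ₗ F.splines.subtype.restrictScalars ℚ) =
      F.chainDeg (n + 1) k ⊓ (LinearMap.ker (F.boundary B n)).restrictScalars ℚ := by
  apply le_antisymm
  · rintro _ ⟨f, hf, rfl⟩
    refine ⟨fun σ _ => ⟨_, zsmul_mem (hf σ.toMaxCone trivial) _, rfl⟩, ?_⟩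
    exact (F.mem_splines_iff B f.1).1 f.2
  · rintro x ⟨hx, hker⟩
    have hp : ∀ σ : F.InteriorFace (n + 1), ∃ p, p ∈ homogeneousSubmodule (Fin (n + 1)) ℚ k ∧
      (coneIdeal σ.1).mkQ p = x σ := fun σ => hx σ trivial
    choose p hp hpx using hp
    let f : F.MaxCone → MvPolynomial (Fin (n + 1)) ℚ := fun α =>
      F.orientationSign B α.toInteriorFace • p α.toInteriorFace
    have hfx : F.toChain B f = x := by
      refine funext fun σ => ?_
      rw [← hpx]
      change (coneIdeal σ.1).mkQ (F.orientationSign B σ • F.orientationSign B σ • p σ) = _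
      rw [smul_smul, orientationSign_mul_self, one_smul]
    have hf : f ∈ F.splines := by
      rw [F.mem_splines_iff B, hfx]
      exact hker
    exact ⟨⟨f, hf⟩, fun α _ => zsmul_mem (hp _) _, hfx⟩

/-- Splines of degree `k` are the cycles of degree `k` of maximal dimension. -/
noncomputable def splinesDegEquiv (k : ℕ) : F.splinesDeg k ≃ₗ[ℚ]
    (F.chainDeg (n + 1) k ⊓ (LinearMap.ker (F.boundary B n)).restrictScalars ℚ :
      Submodule ℚ (F.Chain (n + 1))) :=
  (Submodule.equivMapOfInjective (F.toChain B ∘ₗ F.splines.subtype.restrictScalars ℚ)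
    ((F.toChain_injective B).comp F.splines.subtype_injective) _).trans
      (LinearEquiv.ofEq _ _ (F.map_toChain_splinesDeg B k))

end Top

end PolyhedralFan

/-! ### Gradings of cycles and homology, and the Euler characteristic -/

namespace PolyhedralFan

variable {d : ℕ} (F : PolyhedralFan d) (B : F.Orienting)

lemma chainGrading_proj_apply (i k : ℕ) (x : F.Chain i) (σ : F.InteriorFace i)
    (p : MvPolynomial (Fin d) ℚ) (hp : (coneIdeal σ.1).mkQ p = x σ) :
    (F.chainGrading i).proj k x σ = (coneIdeal σ.1).mkQ (homogeneousComponent k p) := by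
  change ((GradedProj.mvPolynomial (Fin d)).quotient (coneIdeal σ.1) _).proj k (x σ) = _
  rw [← hp]
  rfl

/-- The differential has degree zero, being built from integer multiples of projections; hence
cycles and boundaries are homogeneous. -/
lemma boundary_proj (i k : ℕ) (x : F.Chain (i + 1)) :
    F.boundary B i ((F.chainGrading (i + 1)).proj k x) =
      (F.chainGrading i).proj k (F.boundary B i x) := by
  have hp : ∀ σ, ∃ p, (coneIdeal σ.1).mkQ p = x σ := fun σ => Submodule.mkQ_surjective _ (x σ)
  choose p hp using hp
  refine funext fun τ => ?_
  rw [boundary_apply, F.chainGrading_proj_apply i k _ τ (∑ σ, F.incidence B σ τ • p σ)]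
  · rw [map_sum, map_sum]
    refine Finset.sum_congr rfl fun σ _ => ?_
    rw [F.chainGrading_proj_apply (i + 1) k x σ (p σ) (hp σ), boundaryComponent_mk, map_zsmul,
      map_zsmul]
  · rw [boundary_apply, map_sum]
    refine Finset.sum_congr rfl fun σ _ => ?_
    rw [← hp, boundaryComponent_mk, map_zsmul]

lemma proj_mem_cycles (i k : ℕ) (x : F.Chain i) (hx : x ∈ F.cycles B i) :
    (F.chainGrading i).proj k x ∈ F.cycles B i := by
  match i with
  | 0 =>
    have h0 : x = 0 := hx
    rw [h0, map_zero]
    exact zero_mem _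
  | 1 => trivial
  | i + 2 =>
    have h0 : F.boundary B (i + 1) x = 0 := hx
    change F.boundary B (i + 1) _ = 0
    rw [boundary_proj, h0, map_zero]

/-- The grading of the cycles. -/
noncomputable def cyclesGrading (i : ℕ) : GradedProj (Fin d) (F.cycles B i) :=
  (F.chainGrading i).restrict (F.cycles B i) (F.proj_mem_cycles B i)

lemma proj_mem_boundaries (i k : ℕ) (x : F.cycles B i)
    (hx : x ∈ (LinearMap.range (F.boundary B i)).submoduleOf (F.cycles B i)) :
    (F.cyclesGrading B i).proj k x ∈
      (LinearMap.range (F.boundary B i)).submoduleOf (F.cycles B i) := by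
  obtain ⟨y, hy⟩ := hx
  refine ⟨(F.chainGrading (i + 1)).proj k y, ?_⟩
  rw [boundary_proj, hy]
  rfl

/-- The grading of the homology. -/
noncomputable def homologyGrading (i : ℕ) : GradedProj (Fin d) (F.Homology B i) :=
  (F.cyclesGrading B i).quotient _ (F.proj_mem_boundaries B i)

lemma cyclesGrading_deg (i k : ℕ) : (F.cyclesGrading B i).deg k =
    (F.chainDeg i k).comap ((F.cycles B i).subtype.restrictScalars ℚ) := by
  ext x
  rw [← chainGrading_deg, Submodule.mem_comap, GradedProj.mem_deg, GradedProj.mem_deg]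
  exact Subtype.ext_iff

lemma homologyGrading_deg (i k : ℕ) : (F.homologyGrading B i).deg k = F.homologyDeg B i k := by
  refine (GradedProj.quotient_deg _ _ _ k).trans ?_
  rw [cyclesGrading_deg]
  rfl

/-- Homology is a subquotient of a finitely generated module over a Noetherian ring, so
Hilbert–Serre applies. -/
lemma exists_isHilbertPolynomial_homologyDeg (i : ℕ) :
    ∃ P, IsHilbertPolynomial (F.homologyDeg B i) P := by
  have h : F.homologyDeg B i = (F.homologyGrading B i).deg :=
    funext fun k => (F.homologyGrading_deg B i k).symm
  rw [h]
  exact (F.homologyGrading B i).exists_isHilbertPolynomial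

instance (i k : ℕ) : Module.Finite ℚ (F.chainDeg i k) := by
  rw [← chainGrading_deg]
  exact (F.chainGrading i).finite_deg k

lemma range_boundary_le_cycles (i : ℕ) :
    LinearMap.range (F.boundary B (i + 1)) ≤ F.cycles B (i + 1) := by
  cases i with
  | zero => exact le_top
  | succ i => exact LinearMap.range_le_ker_iff.2 (F.boundary_comp_boundary B (i + 1))

lemma finrank_homologyDeg_add (i k : ℕ) :
    Module.finrank ℚ (F.homologyDeg B (i + 1) k) +
      Module.finrank ℚ ((F.chainDeg (i + 2) k).map ((F.boundary B (i + 1)).restrictScalars ℚ)) =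
    Module.finrank ℚ (F.chainDeg (i + 1) k ⊓ (F.cycles B (i + 1)).restrictScalars ℚ :
      Submodule ℚ (F.Chain (i + 1))) := by
  have := (F.cyclesGrading B (i + 1)).finite_deg k
  have h1 := ((F.cyclesGrading B (i + 1)).deg k).finrank_map_add_finrank_inf_ker
    (((LinearMap.range (F.boundary B (i + 1))).submoduleOf (F.cycles B (i + 1))).mkQ.restrictScalars
      ℚ)
  have h2 := GradedProj.finrank_restrict_deg (F.chainGrading (i + 1)) (F.cycles B (i + 1))
    (F.proj_mem_cycles B (i + 1)) k
  rw [chainGrading_deg] at h2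
  have h3 : ((F.cyclesGrading B (i + 1)).deg k ⊓ LinearMap.ker
      (((LinearMap.range (F.boundary B (i + 1))).submoduleOf
        (F.cycles B (i + 1))).mkQ.restrictScalars ℚ)).map
          ((F.cycles B (i + 1)).subtype.restrictScalars ℚ) =
      (F.chainDeg (i + 2) k).map ((F.boundary B (i + 1)).restrictScalars ℚ) := by
    ext x
    constructor
    · rintro ⟨y, ⟨hy, hyr⟩, rfl⟩
      obtain ⟨z, hz⟩ := (Submodule.Quotient.mk_eq_zero _).1 hyr
      -- A boundary of degree k is the boundary of the degree-k component of any chain that it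
      -- bounds.
      refine ⟨(F.chainGrading (i + 2)).proj k z, ?_, ?_⟩
      · rw [← chainGrading_deg]
        exact ⟨z, rfl⟩
      · refine (F.boundary_proj B (i + 1) k z).trans ?_
        rw [hz]
        exact congrArg Subtype.val (GradedProj.mem_deg.1 hy)
    · rintro ⟨z, hz, rfl⟩
      rw [SetLike.mem_coe, ← chainGrading_deg, GradedProj.mem_deg] at hz
      refine ⟨⟨F.boundary B (i + 1) z, F.range_boundary_le_cycles B i ⟨z, rfl⟩⟩, ⟨?_, ?_⟩, rfl⟩
      · refine GradedProj.mem_deg.2 (Subtype.ext ?_)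
        refine (F.boundary_proj B (i + 1) k z).symm.trans ?_
        rw [hz]
      · exact (Submodule.Quotient.mk_eq_zero _).2 ⟨z, rfl⟩
  rw [← h2]
  refine Eq.trans ?_ h1
  congr 1
  · rw [cyclesGrading_deg]
    rfl
  · rw [← h3]
    exact (Submodule.equivMapOfInjective ((F.cycles B (i + 1)).subtype.restrictScalars ℚ)
      (F.cycles B (i + 1)).subtype_injective _).finrank_eq.symm

lemma finrank_boundaries_add (i k : ℕ) :
    Module.finrank ℚ ((F.chainDeg (i + 1) k).map ((F.boundary B i).restrictScalars ℚ)) +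
      Module.finrank ℚ (F.chainDeg (i + 1) k ⊓ (LinearMap.ker (F.boundary B i)).restrictScalars ℚ :
        Submodule ℚ (F.Chain (i + 1))) = Module.finrank ℚ (F.chainDeg (i + 1) k) :=
  (F.chainDeg (i + 1) k).finrank_map_add_finrank_inf_ker ((F.boundary B i).restrictScalars ℚ)

/-- The Euler characteristic of the truncated complex in degree `k`. -/
lemma finrank_cycles_eq (m k : ℕ) :
    (Module.finrank ℚ (F.chainDeg (m + 1) k ⊓ (F.cycles B (m + 1)).restrictScalars ℚ :
      Submodule ℚ (F.Chain (m + 1))) : ℚ) =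
    ∑ i ∈ Finset.Icc 1 (m + 1), (-1) ^ (m + 1 - i) * (Module.finrank ℚ (F.chainDeg i k) : ℚ) +
      ∑ i ∈ Finset.Icc 1 m, (-1) ^ (m - i) * (Module.finrank ℚ (F.homologyDeg B i k) : ℚ) := by
  induction m with
  | zero =>
    have : (F.chainDeg (0 + 1) k ⊓ (F.cycles B (0 + 1)).restrictScalars ℚ :
      Submodule ℚ (F.Chain (0 + 1))) = F.chainDeg (0 + 1) k := inf_eq_left.2 fun _ _ => trivial
    rw [this]
    simp
  | succ m ih =>
    have h1 := F.finrank_homologyDeg_add B m k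
    have h2 := F.finrank_boundaries_add B (m + 1) k
    have h1' := congrArg (Nat.cast (R := ℚ)) h1
    have h2' := congrArg (Nat.cast (R := ℚ)) h2
    rw [Nat.cast_add, ih] at h1'
    rw [Nat.cast_add] at h2'
    -- Raising the top index flips every earlier sign, matching dim Z_{m+2} = dim C_{m+2} - (dim
    -- Z_{m+1} - dim H_{m+1}).
    have hs : ∀ (r : ℕ) (f : ℕ → ℚ), ∑ i ∈ Finset.Icc 1 (r + 1), (-1) ^ (r + 1 - i) * f i =
        f (r + 1) - ∑ i ∈ Finset.Icc 1 r, (-1) ^ (r - i) * f i := by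
      intro r f
      rw [Finset.sum_Icc_succ_top (by omega), Nat.sub_self, pow_zero, one_mul, add_comm,
        sub_eq_add_neg, ← Finset.sum_neg_distrib]
      congr 1
      refine Finset.sum_congr rfl fun i hi => ?_
      rw [Nat.succ_sub (Finset.mem_Icc.1 hi).2, pow_succ]
      ring
    rw [hs (m + 1), hs m fun i => (Module.finrank ℚ (F.homologyDeg B i k) : ℚ)]
    change (Module.finrank ℚ (F.chainDeg (m + 1 + 1) k ⊓
      (LinearMap.ker (F.boundary B (m + 1))).restrictScalars ℚ : Submodule ℚ (F.Chain (m + 1 + 1)))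
        : ℚ) = _
    linarith

/-- Only n = 0 has content: there all chains count as cycles, while `boundary` maps to `Chain 0`,
which is zero in positive degree. -/
lemma chainDeg_inf_ker_eq {n : ℕ} (F : PolyhedralFan (n + 1)) (B : F.Orienting) (k : ℕ) :
    (F.chainDeg (n + 1) (k + 1) ⊓ (LinearMap.ker (F.boundary B n)).restrictScalars ℚ :
      Submodule ℚ (F.Chain (n + 1))) =
    F.chainDeg (n + 1) (k + 1) ⊓ (F.cycles B (n + 1)).restrictScalars ℚ := by
  cases n with
  | zero =>
    refine le_antisymm (inf_le_inf le_rfl fun _ _ => trivial) fun x hx => ⟨hx.1, ?_⟩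
    change F.boundary B 0 x = 0
    have hx' : x ∈ (F.chainGrading 1).deg (k + 1) := by
      rw [chainGrading_deg]
      exact hx.1
    rw [GradedProj.mem_deg] at hx'
    have h0 : F.boundary B 0 x ∈ F.chainDeg 0 (k + 1) := by
      rw [← chainGrading_deg, GradedProj.mem_deg, ← boundary_proj, hx']
    rwa [chainDeg_zero_succ, Submodule.mem_bot] at h0
  | succ n => rfl

lemma isHilbertPolynomial_splinesDeg {n : ℕ} (F : PolyhedralFan (n + 1)) (B : F.Orienting)
    (H : ℕ → Polynomial ℚ) (hH : ∀ i, IsHilbertPolynomial (F.homologyDeg B i) (H i)) :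
    IsHilbertPolynomial F.splinesDeg
      (∑ i ∈ Finset.Icc 1 (n + 1), (-1) ^ (n + 1 - i) *
        (Fintype.card (F.InteriorFace i) : Polynomial ℚ) * binomialPoly (i - 1) +
      ∑ i ∈ Finset.Icc 1 n, (-1) ^ (n - i) * H i) := by
  refine ⟨fun k => ?_, ?_⟩
  · have : Module.Finite ℚ (F.chainDeg (n + 1) k ⊓
        (LinearMap.ker (F.boundary B n)).restrictScalars ℚ : Submodule ℚ (F.Chain (n + 1))) :=
      Submodule.finiteDimensional_of_le inf_le_left
    exact Module.Finite.equiv (F.splinesDegEquiv B k).symm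
  · have hall : ∀ᶠ k : ℕ in atTop, ∀ i ∈ Finset.Icc 1 n,
        (H i).eval (k : ℚ) = (Module.finrank ℚ (F.homologyDeg B i k) : ℚ) :=
      (Filter.eventually_all_finset _).2 fun i _ => (hH i).2
    -- Degree k = 0 is excluded because splines and cycles are compared only in positive degree.
    filter_upwards [hall, eventually_ge_atTop 1] with k hk hk1
    obtain ⟨k, rfl⟩ := Nat.exists_eq_add_of_le' hk1
    rw [(F.splinesDegEquiv B (k + 1)).finrank_eq, chainDeg_inf_ker_eq, finrank_cycles_eq,
      Polynomial.eval_add, Polynomial.eval_finsetSum, Polynomial.eval_finsetSum]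
    congr 1
    · refine Finset.sum_congr rfl fun i hi => ?_
      obtain ⟨i, rfl⟩ := Nat.exists_eq_add_of_le' (Finset.mem_Icc.1 hi).1
      rw [F.finrank_chainDeg_succ B, Nat.add_sub_cancel, Polynomial.eval_mul, Polynomial.eval_mul,
        binomialPoly_eval]
      simp [mul_assoc]
    · refine Finset.sum_congr rfl fun i hi => ?_
      rw [← hk i hi]
      simp

/-- Polynomials in no variables are constants, so every piece of positive degree is zero. -/
lemma isHilbertPolynomial_splinesDeg_zero (F : PolyhedralFan 0) :
    IsHilbertPolynomial F.splinesDeg 0 := by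
  constructor
  · intro k
    have : Module.Finite ℚ (MvPolynomial (Fin 0) ℚ) :=
      Module.Finite.equiv (isEmptyAlgEquiv ℚ (Fin 0)).symm.toLinearEquiv
    exact Module.Finite.of_injective
      (F.splines.subtype.restrictScalars ℚ ∘ₗ (F.splinesDeg k).subtype)
      (F.splines.subtype_injective.comp (F.splinesDeg k).subtype_injective)
  · filter_upwards [eventually_ge_atTop 1] with k hk
    have h : F.splinesDeg k = ⊥ := by
      rw [eq_bot_iff]
      intro f hf
      refine Subtype.ext (funext fun α => ?_)
      by_contra hne
      have := (isHomogeneous_of_isEmpty _ _ (f.1 α)).inj_right (hf α trivial) hne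
      omega
    rw [h]
    simp

end PolyhedralFan

/-! ### Chosen Hilbert polynomials and the conclusion -/

lemma IsHilbertPolynomial.hilbertPolynomial_eq {M : Type*} [AddCommGroup M] [Module ℚ M]
    {A : ℕ → Submodule ℚ M} {P : Polynomial ℚ} (h : IsHilbertPolynomial A P) :
    hilbertPolynomial A = P := by
  have hex : ∃ P, IsHilbertPolynomial A P := ⟨P, h⟩
  rw [hilbertPolynomial, dif_pos hex]
  exact hex.choose_spec.unique h

lemma isHilbertPolynomial_hilbertPolynomial {M : Type*} [AddCommGroup M] [Module ℚ M]
    {A : ℕ → Submodule ℚ M} (h : ∃ P, IsHilbertPolynomial A P) :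
    IsHilbertPolynomial A (hilbertPolynomial A) := by
  rw [hilbertPolynomial, dif_pos h]
  exact h.choose_spec

theorem proposition2p2 {d : ℕ} (F : PolyhedralFan d) (hd : F.IsFullDimensional)
    (hF : F.IsHereditary) (B : F.Orienting) :
    (∀ i, F.boundary B i ∘ₗ F.boundary B (i + 1) = 0) ∧
    IsHilbertPolynomial F.splinesDeg (hilbertPolynomial F.splinesDeg) ∧
    (∀ i ∈ Finset.Icc 1 (d - 1),
      IsHilbertPolynomial (F.homologyDeg B i) (hilbertPolynomial (F.homologyDeg B i))) ∧
    hilbertPolynomial F.splinesDeg =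
      ∑ i ∈ Finset.Icc 1 d,
        (-1) ^ (d - i) * (Fintype.card (F.InteriorFace i) : Polynomial ℚ) * binomialPoly (i - 1) +
      ∑ i ∈ Finset.Icc 1 (d - 1),
        (-1) ^ (d - 1 - i) * hilbertPolynomial (F.homologyDeg B i) := by
  have hH : ∀ i, IsHilbertPolynomial (F.homologyDeg B i) (hilbertPolynomial (F.homologyDeg B i)) :=
    fun i => isHilbertPolynomial_hilbertPolynomial (F.exists_isHilbertPolynomial_homologyDeg B i)
  cases d with
  | zero =>
    have h := F.isHilbertPolynomial_splinesDeg_zero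
    exact ⟨F.boundary_comp_boundary B, isHilbertPolynomial_hilbertPolynomial ⟨_, h⟩,
      fun i _ => hH i, by simp [h.hilbertPolynomial_eq]⟩
  | succ n =>
    have h := F.isHilbertPolynomial_splinesDeg B _ hH
    exact ⟨F.boundary_comp_boundary B, isHilbertPolynomial_hilbertPolynomial ⟨_, h⟩,
      fun i _ => hH i, h.hilbertPolynomial_eq⟩
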